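/- Let $\mathcal H$ be a complex Hilbert space and $H\subset\mathcal H$ a factorial standard subspace, i.e. a closed real linear subspace with $\overline{H+iH}=\mathcal H$, $H\cap iH=\{0\}$ and $H\cap H'=\{0\}$, where $H'=\{k\in\mathcal H : \Im(h,k)=0 \text{ for all } h\in H\}$ is the symplectic complement of $H$. Let $\Delta=S^*S$ be the modular operator of $H$, where $S$ is the closed antilinear operator with domain $H+iH$ given by $S(h_1+ih_2)=h_1-ih_2$ for $h_1,h_2\in H$; $\Delta$ is a positive, non-singular, self-adjoint operator, and functions of $\Delta$ are defined by the spectral theorem. Let $H+H'$ denote the (not necessarily closed) algebraic sum. Let $f:(0,+\infty)\to\mathbb C$ be a continuous function such that $f(\lambda)=O(\lambda-1)$ as $\lambda\to1$. Then $\mathrm{Ran}(f(\Delta))\subset H+H'$, i.e. $f(\Delta)k\in H+H'$ for every $k\in\mathrm{Dom}(f(\Delta))$. In particular, $$k-\Delta^{is}k\in H+H'\quad\text{for all }k\in\mathcal H,\ s\in\mathbb R,$$ and $$\log\Delta\,k\in H+H'\quad\text{for all }k\in\mathrm{Dom}(\log\Delta).$$ -/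

import Mathlib

open MeasureTheory Filter Topology Complex Asymptotics
open scoped ENNReal InnerProductSpace

noncomputable section

/-! ### Projection-valued measures on the real line and their integrals -/

/-- A projection-valued measure on the Borel sets of `ℝ` acting on the Hilbert space `𝓗`
(its values on non-measurable sets are irrelevant). -/
structure ProjValuedMeasure (𝓗 : Type*) [NormedAddCommGroup 𝓗] [InnerProductSpace ℂ 𝓗]
    [CompleteSpace 𝓗] where
  /-- The projection attached to a Borel set. -/
  proj : Set ℝ → 𝓗 →L[ℂ] 𝓗
  isStarProjection : ∀ B, MeasurableSet B → IsStarProjection (proj B)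
  proj_univ : proj Set.univ = 1
  proj_inter : ∀ B C, MeasurableSet B → MeasurableSet C → proj (B ∩ C) = proj B * proj C
  hasSum_proj : ∀ B : ℕ → Set ℝ, (∀ i, MeasurableSet (B i)) → Pairwise (Function.onFun Disjoint B) →
    ∀ x, HasSum (fun i => proj (B i) x) (proj (⋃ i, B i) x)

namespace ProjValuedMeasure

variable {𝓗 : Type*} [NormedAddCommGroup 𝓗] [InnerProductSpace ℂ 𝓗] [CompleteSpace 𝓗]
  (E : ProjValuedMeasure 𝓗)

theorem proj_empty : E.proj ∅ = 0 := by
  ext x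
  have h := E.hasSum_proj (fun _ => ∅) (fun _ => MeasurableSet.empty)
    (fun _ _ _ => disjoint_bot_left) x
  simpa [summable_const_iff] using h.summable

theorem inner_proj_proj {B C : Set ℝ} (hB : MeasurableSet B) (hC : MeasurableSet C) (x y : 𝓗) :
    ⟪E.proj B x, E.proj C y⟫_ℂ = ⟪x, E.proj (B ∩ C) y⟫_ℂ := by
  have h1 := (E.isStarProjection B hB).isSelfAdjoint
  have h2 := ContinuousLinearMap.adjoint_inner_left (E.proj B) (E.proj C y) x
  rw [← ContinuousLinearMap.star_eq_adjoint, h1.star_eq] at h2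
  rw [E.proj_inter B C hB hC, h2]
  rfl

theorem norm_proj_sq {B : Set ℝ} (hB : MeasurableSet B) (x : 𝓗) :
    ‖E.proj B x‖ ^ 2 = (⟪x, E.proj B x⟫_ℂ).re := by
  rw [← inner_self_eq_norm_sq (𝕜 := ℂ), E.inner_proj_proj hB hB, Set.inter_self]
  rfl

/-- The finite Borel measure `B ↦ ⟨x, E(B) x⟩ = ‖E(B) x‖²`. -/
def scalarMeasure (x : 𝓗) : Measure ℝ :=
  Measure.ofMeasurable (fun B _ => ENNReal.ofReal (‖E.proj B x‖ ^ 2))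
    (by simp [E.proj_empty])
    (by
      intro B hB hd
      have h := (E.hasSum_proj B hB hd x).mapL (innerSL ℂ x)
      have h2 := h.mapL Complex.reCLM
      simp only [innerSL_apply_apply, Complex.reCLM_apply] at h2
      rw [E.norm_proj_sq (MeasurableSet.iUnion hB), ← h2.tsum_eq,
        ENNReal.ofReal_tsum_of_nonneg _ h2.summable]
      · simp_rw [E.norm_proj_sq (hB _)]
      · intro i
        rw [← E.norm_proj_sq (hB i)]
        positivity)

theorem scalarMeasure_apply (x : 𝓗) {B : Set ℝ} (hB : MeasurableSet B) :
    E.scalarMeasure x B = ENNReal.ofReal (‖E.proj B x‖ ^ 2) :=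
  Measure.ofMeasurable_apply B hB

/-- The integral `∑ c E(s = c)` of a simple function `s`. -/
def simpleIntegral (s : SimpleFunc ℝ ℂ) : 𝓗 →L[ℂ] 𝓗 :=
  ∑ c ∈ s.range, c • E.proj (s ⁻¹' {c})

/-- `y = (∫ f dE) x`: the function `f` is square integrable for `⟨x, E(·) x⟩`, and `y` is the limit
of `(∫ sₙ dE) x` for simple functions `sₙ` converging to `f` in `L²(⟨x, E(·) x⟩)`. -/
def HasIntegral (f : ℝ → ℂ) (x y : 𝓗) : Prop :=
  MemLp f 2 (E.scalarMeasure x) ∧ ∃ s : ℕ → SimpleFunc ℝ ℂ,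
    Tendsto (fun n => eLpNorm (f - ⇑(s n)) 2 (E.scalarMeasure x)) atTop (𝓝 0) ∧
    Tendsto (fun n => E.simpleIntegral (s n) x) atTop (𝓝 y)

theorem proj_union {B C : Set ℝ} (hB : MeasurableSet B) (hC : MeasurableSet C)
    (hd : Disjoint B C) : E.proj (B ∪ C) = E.proj B + E.proj C := by
  ext x
  let D : ℕ → Set ℝ := fun i => if i = 0 then B else if i = 1 then C else ∅
  have hD : ∀ i, MeasurableSet (D i) := by
    intro i; simp only [D]; split_ifs <;> simp [hB, hC]
  have hdD : Pairwise (Function.onFun Disjoint D) := by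
    intro i j hij
    simp only [Function.onFun, D]
    split_ifs <;> simp_all [disjoint_comm]
  have hU : ⋃ i, D i = B ∪ C := by
    ext t
    simp only [Set.mem_iUnion, Set.mem_union, D]
    constructor
    · rintro ⟨i, hi⟩
      split_ifs at hi <;> simp_all
    · rintro (h | h)
      · exact ⟨0, by simpa using h⟩
      · exact ⟨1, by simpa using h⟩
  have h := E.hasSum_proj D hD hdD x
  rw [hU] at h
  have h2 : HasSum (fun i => E.proj (D i) x) (∑ i ∈ Finset.range 2, E.proj (D i) x) := by
    apply hasSum_sum_of_ne_finset_zero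
    intro i hi
    have h0 : i ≠ 0 := by rintro rfl; simp at hi
    have h1 : i ≠ 1 := by rintro rfl; simp at hi
    simp [D, h0, h1, E.proj_empty]
  rw [h.unique h2]
  simp [Finset.sum_range_succ, D]

theorem simpleIntegral_sub (s t : SimpleFunc ℝ ℂ) :
    E.simpleIntegral (s - t) = E.simpleIntegral s - E.simpleIntegral t := by
  let T : Set ℝ → ℂ →L[ℝ] (𝓗 →L[ℂ] 𝓗) := fun B =>
    ((ContinuousLinearMap.id ℂ ℂ).smulRight (E.proj B)).restrictScalars ℝ
  have hT : FinMeasAdditive (0 : Measure ℝ) T := by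
    intro B C hB hC _ _ hd
    ext c : 1
    simp [T, E.proj_union hB hC hd]
  have key : ∀ u : SimpleFunc ℝ ℂ, E.simpleIntegral u = u.setToSimpleFunc T := fun u => rfl
  rw [key, key, key]
  exact SimpleFunc.setToSimpleFunc_sub T hT (by simp) (by simp)

theorem eLpNorm_simpleFunc (s : SimpleFunc ℝ ℂ) (x : 𝓗) :
    eLpNorm s 2 (E.scalarMeasure x) = ‖E.simpleIntegral s x‖ₑ := by
  have h1 : ‖E.simpleIntegral s x‖ ^ 2 =
      ∑ c ∈ s.range, ‖c‖ ^ 2 * ‖E.proj (s ⁻¹' {c}) x‖ ^ 2 := by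
    have hz : ⟪E.simpleIntegral s x, E.simpleIntegral s x⟫_ℂ =
        ((∑ c ∈ s.range, ‖c‖ ^ 2 * ‖E.proj (s ⁻¹' {c}) x‖ ^ 2 : ℝ) : ℂ) := by
      simp only [simpleIntegral, _root_.sum_apply, _root_.smul_apply,
        sum_inner, inner_sum, inner_smul_left, inner_smul_right]
      push_cast
      refine Finset.sum_congr rfl fun c hc => ?_
      rw [Finset.sum_eq_single_of_mem c hc]
      · rw [inner_self_eq_norm_sq_to_K, ← mul_assoc, mul_comm c, Complex.conj_mul']
        simp
      · intro d _ hdc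
        rw [E.inner_proj_proj (s.measurableSet_fiber _) (s.measurableSet_fiber _)]
        have : s ⁻¹' {d} ∩ s ⁻¹' {c} = ∅ := by
          ext t
          simp only [Set.mem_inter_iff, Set.mem_preimage, Set.mem_singleton_iff,
            Set.mem_empty_iff_false, iff_false, not_and]
          intro h h'
          exact hdc (h.symm.trans h')
        simp [this, E.proj_empty]
    have := inner_self_eq_norm_sq (𝕜 := ℂ) (E.simpleIntegral s x)
    rw [hz] at this
    rw [← this]
    simp only [RCLike.re_to_complex, Complex.ofReal_re]
  have h2 : eLpNorm s 2 (E.scalarMeasure x) ^ 2 = ‖E.simpleIntegral s x‖ₑ ^ 2 := by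
    have e1 : ‖E.simpleIntegral s x‖ₑ ^ 2 = ENNReal.ofReal (‖E.simpleIntegral s x‖ ^ 2) := by
      rw [← ofReal_norm, ENNReal.ofReal_pow (norm_nonneg _)]
    rw [e1, h1, ENNReal.ofReal_sum_of_nonneg (fun _ _ => by positivity)]
    have e2 : eLpNorm s 2 (E.scalarMeasure x) ^ 2 =
        ∫⁻ t, ‖s t‖ₑ ^ 2 ∂(E.scalarMeasure x) := by
      rw [eLpNorm_eq_lintegral_rpow_enorm_toReal (by norm_num) (by norm_num)]
      rw [← ENNReal.rpow_natCast, ← ENNReal.rpow_mul]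
      norm_num
    have e3 : ∫⁻ t, ‖s t‖ₑ ^ 2 ∂(E.scalarMeasure x) =
        (s.map fun c : ℂ => ‖c‖ₑ ^ 2).lintegral (E.scalarMeasure x) := by
      rw [← SimpleFunc.lintegral_eq_lintegral]
      simp
    rw [e2, e3, SimpleFunc.map_lintegral]
    refine Finset.sum_congr rfl fun c _ => ?_
    rw [E.scalarMeasure_apply x (s.measurableSet_fiber c), ENNReal.ofReal_mul (by positivity),
      ← ofReal_norm, ENNReal.ofReal_pow (norm_nonneg c)]
  exact (ENNReal.pow_right_strictMono two_ne_zero).injective h2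

/-- The limit in `HasIntegral` does not depend on the approximating sequence. -/
theorem HasIntegral.tendsto {E : ProjValuedMeasure 𝓗} {f : ℝ → ℂ} {x y : 𝓗}
    (h : E.HasIntegral f x y) {t : ℕ → SimpleFunc ℝ ℂ}
    (ht : Tendsto (fun n => eLpNorm (f - ⇑(t n)) 2 (E.scalarMeasure x)) atTop (𝓝 0)) :
    Tendsto (fun n => E.simpleIntegral (t n) x) atTop (𝓝 y) := by
  obtain ⟨hf, s, hs, hy⟩ := h
  have hb : ∀ n, ‖E.simpleIntegral (t n) x - E.simpleIntegral (s n) x‖ₑ ≤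
      eLpNorm (f - ⇑(s n)) 2 (E.scalarMeasure x) + eLpNorm (f - ⇑(t n)) 2 (E.scalarMeasure x) := by
    intro n
    rw [← _root_.sub_apply, ← E.simpleIntegral_sub, ← E.eLpNorm_simpleFunc]
    have : (⇑(t n - s n) : ℝ → ℂ) = (f - ⇑(s n)) - (f - ⇑(t n)) := by
      ext u; simp
    rw [this]
    exact eLpNorm_sub_le (hf.1.sub (s n).aestronglyMeasurable)
      (hf.1.sub (t n).aestronglyMeasurable) (by norm_num)
  have hlim : Tendsto (fun n => E.simpleIntegral (t n) x - E.simpleIntegral (s n) x) atTop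
      (𝓝 0) := by
    rw [tendsto_zero_iff_enorm_tendsto_zero]
    exact tendsto_of_tendsto_of_tendsto_of_le_of_le tendsto_const_nhds
      (by simpa using hs.add ht) (fun _ => zero_le) hb
  simpa using hlim.add hy

theorem exists_approx {f : ℝ → ℂ} {μ : Measure ℝ} (hf : MemLp f 2 μ) :
    ∃ t : ℕ → SimpleFunc ℝ ℂ, Tendsto (fun n => eLpNorm (f - ⇑(t n)) 2 μ) atTop (𝓝 0) := by
  have h : ∀ n : ℕ, ∃ g : SimpleFunc ℝ ℂ, eLpNorm (f - ⇑g) 2 μ < ((n : ℝ≥0∞) + 1)⁻¹ := by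
    intro n
    obtain ⟨g, hg, -⟩ := hf.exists_simpleFunc_eLpNorm_sub_lt (by norm_num)
      (ε := ((n : ℝ≥0∞) + 1)⁻¹) (by simp)
    exact ⟨g, hg⟩
  choose t ht using h
  refine ⟨t, tendsto_of_tendsto_of_tendsto_of_le_of_le tendsto_const_nhds ?_
    (fun _ => zero_le) fun n => (ht n).le⟩
  simpa using (tendsto_add_atTop_iff_nat 1).2 ENNReal.tendsto_inv_nat_nhds_zero

theorem scalarMeasure_add_le (x y : 𝓗) :
    E.scalarMeasure (x + y) ≤ (2 : ℝ≥0∞) • (E.scalarMeasure x + E.scalarMeasure y) := by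
  refine Measure.le_iff.2 fun B hB => ?_
  simp only [Measure.smul_apply, Measure.add_apply, smul_eq_mul, E.scalarMeasure_apply _ hB]
  rw [← ENNReal.ofReal_add (by positivity) (by positivity),
    show (2 : ℝ≥0∞) = ENNReal.ofReal 2 by simp, ← ENNReal.ofReal_mul (by norm_num)]
  refine ENNReal.ofReal_le_ofReal ?_
  have h := norm_add_le (E.proj B x) (E.proj B y)
  rw [map_add]
  nlinarith [norm_nonneg (E.proj B x + E.proj B y), sq_nonneg (‖E.proj B x‖ - ‖E.proj B y‖)]

theorem scalarMeasure_smul (c : ℂ) (x : 𝓗) :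
    E.scalarMeasure (c • x) = ENNReal.ofReal (‖c‖ ^ 2) • E.scalarMeasure x := by
  ext B hB
  simp only [Measure.smul_apply, smul_eq_mul, E.scalarMeasure_apply _ hB]
  rw [← ENNReal.ofReal_mul (by positivity), map_smul, norm_smul, mul_pow]

theorem scalarMeasure_zero : E.scalarMeasure 0 = 0 := by
  ext B hB
  simp [E.scalarMeasure_apply _ hB]

theorem hasIntegral_zero (f : ℝ → ℂ) : E.HasIntegral f 0 0 := by
  refine ⟨by simp [E.scalarMeasure_zero], fun _ => 0, ?_, ?_⟩ <;> simp [E.scalarMeasure_zero]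

theorem HasIntegral.add {E : ProjValuedMeasure 𝓗} {f : ℝ → ℂ} {x y x' y' : 𝓗}
    (h : E.HasIntegral f x y) (h' : E.HasIntegral f x' y') :
    E.HasIntegral f (x + x') (y + y') := by
  have hle := E.scalarMeasure_add_le x x'
  have hm : MemLp f 2 ((2 : ℝ≥0∞) • (E.scalarMeasure x + E.scalarMeasure x')) := by
    refine MemLp.smul_measure ⟨h.1.1.add_measure h'.1.1, ?_⟩ (by norm_num)
    have h1 := (eLpNorm_lt_top_iff_lintegral_rpow_enorm_lt_top two_ne_zero (by norm_num)).1 h.1.2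
    have h2 := (eLpNorm_lt_top_iff_lintegral_rpow_enorm_lt_top two_ne_zero (by norm_num)).1 h'.1.2
    rw [eLpNorm_lt_top_iff_lintegral_rpow_enorm_lt_top two_ne_zero (by norm_num),
      lintegral_add_measure]
    exact ENNReal.add_lt_top.2 ⟨h1, h2⟩
  obtain ⟨t, ht⟩ := exists_approx hm
  have mono : ∀ ν : Measure ℝ, ν ≤ (2 : ℝ≥0∞) • (E.scalarMeasure x + E.scalarMeasure x') →
      Tendsto (fun n => eLpNorm (f - ⇑(t n)) 2 ν) atTop (𝓝 0) := fun ν hν =>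
    tendsto_of_tendsto_of_tendsto_of_le_of_le tendsto_const_nhds ht
      (fun _ => zero_le) fun n => eLpNorm_mono_measure _ hν
  have h2 : ∀ ν : Measure ℝ, ν ≤ (2 : ℝ≥0∞) • ν := fun ν => by
    refine Measure.le_iff.2 fun B _ => ?_
    simp only [Measure.smul_apply, smul_eq_mul, two_mul]
    exact le_self_add
  have l1 := h.tendsto (mono _ ((Measure.le_add_right le_rfl).trans (h2 _)))
  have l2 := h'.tendsto (mono _ ((Measure.le_add_left le_rfl).trans (h2 _)))
  exact ⟨hm.mono_measure hle, t, mono _ hle, by simpa using l1.add l2⟩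

theorem HasIntegral.smul {E : ProjValuedMeasure 𝓗} {f : ℝ → ℂ} {x y : 𝓗} (c : ℂ)
    (h : E.HasIntegral f x y) : E.HasIntegral f (c • x) (c • y) := by
  obtain ⟨hf, s, hs, hy⟩ := h
  refine ⟨?_, s, ?_, by simpa using hy.const_smul c⟩
  · rw [E.scalarMeasure_smul]
    exact hf.smul_measure ENNReal.ofReal_ne_top
  · have : ∀ n, eLpNorm (f - ⇑(s n)) 2 (E.scalarMeasure (c • x)) =
        ENNReal.ofReal (‖c‖ ^ 2) ^ ((1 : ℝ) / 2) * eLpNorm (f - ⇑(s n)) 2 (E.scalarMeasure x) := by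
      intro n
      rw [E.scalarMeasure_smul, eLpNorm_smul_measure_of_ne_top (by norm_num)]
      simp
    simp_rw [this]
    simpa using ENNReal.Tendsto.const_mul hs (Or.inr (by finiteness))

/-- The graph of the (generally unbounded) operator `∫ f dE`. -/
def integralGraph (f : ℝ → ℂ) : Submodule ℂ (𝓗 × 𝓗) where
  carrier := {p | E.HasIntegral f p.1 p.2}
  zero_mem' := E.hasIntegral_zero f
  add_mem' h h' := h.add h'
  smul_mem' c _ h := h.smul c

/-- The value of `∫ f dE` at a vector is unique. -/
theorem integralGraph_single_valued (f : ℝ → ℂ) (p : 𝓗 × 𝓗) (hp : p ∈ E.integralGraph f)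
    (h0 : p.1 = 0) : p.2 = 0 := by
  obtain ⟨x, y⟩ := p
  obtain rfl : x = 0 := h0
  obtain ⟨-, s, -, hy⟩ : E.HasIntegral f 0 y := hp
  simpa [eq_comm] using hy

/-- The operator `∫ f dE`. Its domain consists of the vectors `x` for which `f` is square integrable
with respect to `⟨x, E(·) x⟩`. -/
def integral (f : ℝ → ℂ) : 𝓗 →ₗ.[ℂ] 𝓗 :=
  (E.integralGraph f).toLinearPMap

theorem mem_integral_domain (f : ℝ → ℂ) (x : 𝓗) :
    x ∈ (E.integral f).domain ↔ MemLp f 2 (E.scalarMeasure x) := by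
  constructor
  · rintro ⟨p, hp, rfl⟩
    exact hp.1
  · intro hf
    obtain ⟨t, ht⟩ := exists_approx hf
    have hc : CauchySeq fun n => E.simpleIntegral (t n) x := by
      refine Metric.cauchySeq_iff.2 fun ε hε => ?_
      obtain ⟨N, hN⟩ := (ENNReal.tendsto_atTop_zero.1 ht) (ENNReal.ofReal (ε / 3))
        (by simpa using hε)
      refine ⟨N, fun m hm n hn => ?_⟩
      rw [dist_eq_norm, ← ENNReal.ofReal_lt_ofReal_iff hε, ofReal_norm,
        ← _root_.sub_apply, ← E.simpleIntegral_sub, ← E.eLpNorm_simpleFunc]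
      have : (⇑(t m - t n) : ℝ → ℂ) = (f - ⇑(t n)) - (f - ⇑(t m)) := by
        ext u; simp
      rw [this]
      refine ((eLpNorm_sub_le (hf.1.sub (t n).aestronglyMeasurable)
        (hf.1.sub (t m).aestronglyMeasurable) (by norm_num)).trans
        (add_le_add (hN n hn) (hN m hm))).trans_lt ?_
      rw [← ENNReal.ofReal_add (by positivity) (by positivity)]
      exact (ENNReal.ofReal_lt_ofReal_iff hε).2 (by linarith)
    obtain ⟨y, hy⟩ := cauchySeq_tendsto_of_complete hc
    exact ⟨(x, y), ⟨hf, t, ht, hy⟩, rfl⟩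

end ProjValuedMeasure

/-- The Borel functional calculus: `f(A) = ∫ f dE`, with `E` the spectral measure of the
self-adjoint operator `A`, which is the projection-valued measure such that `A = ∫ λ dE(λ)`.
An operator that has no spectral measure gets the operator with domain `{0}`. -/
def borelCalculus {𝓗 : Type*} [NormedAddCommGroup 𝓗] [InnerProductSpace ℂ 𝓗] [CompleteSpace 𝓗]
    (A : 𝓗 →ₗ.[ℂ] 𝓗) (f : ℝ → ℂ) : 𝓗 →ₗ.[ℂ] 𝓗 :=
  open Classical in
  if h : ∃ E : ProjValuedMeasure 𝓗, E.integral (fun t => (t : ℂ)) = A then h.choose.integral f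
  else ⊥

/-! ### Modular theory of a standard subspace -/

namespace StandardSubspace

theorem smul_decomp {𝓗 : Type*} [NormedAddCommGroup 𝓗] [InnerProductSpace ℂ 𝓗] (c : ℂ) (h k : 𝓗) :
    c • (h + I • k) = (c.re • h - c.im • k) + I • (c.re • k + c.im • h) := by
  have hc : ∀ v : 𝓗, c • v = c.re • v + c.im • (I • v) := fun v => by
    conv_lhs => rw [← Complex.re_add_im c]
    rw [add_smul, mul_smul, Complex.coe_smul, Complex.coe_smul]
  rw [smul_add, hc h, hc (I • k), smul_smul I I, I_mul_I, smul_add, smul_comm I c.re,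
    smul_comm I c.im, neg_one_smul, smul_neg]
  abel

variable {𝓗 : Type*} [NormedAddCommGroup 𝓗] [InnerProductSpace ℂ 𝓗] (K : StandardSubspace 𝓗)

theorem decomp_unique {h k h' k' : 𝓗} (hh : h ∈ K.toClosedSubmodule.toSubmodule)
    (hk : k ∈ K.toClosedSubmodule.toSubmodule) (hh' : h' ∈ K.toClosedSubmodule.toSubmodule)
    (hk' : k' ∈ K.toClosedSubmodule.toSubmodule)
    (e : h + I • k = h' + I • k') : h = h' ∧ k = k' := by
  have e1 : h - h' = I • (k' - k) := by
    rw [smul_sub, sub_eq_sub_iff_add_eq_add, e, add_comm]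
  have m1 : h - h' ∈ K.toClosedSubmodule.toSubmodule := sub_mem hh hh'
  have m2 : h - h' ∈ K.toClosedSubmodule.mulI := by
    rw [ClosedSubmodule.mem_mapEquiv_iff, scalarSMulCLE_symm_apply, e1]
    have : (UnitI⁻¹ : ℂˣ) • (I • (k' - k)) = k' - k := inv_smul_smul UnitI (k' - k)
    rw [this]
    exact (sub_mem hk' hk : k' - k ∈ K.toClosedSubmodule.toSubmodule)
  have m3 : h - h' ∈ K.toClosedSubmodule ⊓ K.toClosedSubmodule.mulI := ⟨m1, m2⟩
  rw [K.IsSeparating] at m3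
  have z : h - h' = 0 := m3
  have z2 : k' - k = 0 := by
    rw [z] at e1
    exact (smul_eq_zero.1 e1.symm).resolve_left I_ne_zero
  exact ⟨sub_eq_zero.1 z, (sub_eq_zero.1 z2).symm⟩

/-- The complex subspace `K + iK`. -/
def tomitaDomain : Submodule ℂ 𝓗 where
  carrier := {x | ∃ h ∈ K.toClosedSubmodule.toSubmodule, ∃ k ∈ K.toClosedSubmodule.toSubmodule,
    x = h + I • k}
  zero_mem' := ⟨0, zero_mem _, 0, zero_mem _, by simp⟩
  add_mem' := by
    rintro _ _ ⟨h, hh, k, hk, rfl⟩ ⟨h', hh', k', hk', rfl⟩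
    exact ⟨h + h', add_mem hh hh', k + k', add_mem hk hk', by rw [smul_add]; abel⟩
  smul_mem' := by
    rintro c _ ⟨h, hh, k, hk, rfl⟩
    refine ⟨c.re • h - c.im • k, sub_mem (Submodule.smul_mem _ _ hh) (Submodule.smul_mem _ _ hk),
      c.re • k + c.im • h, add_mem (Submodule.smul_mem _ _ hk) (Submodule.smul_mem _ _ hh), ?_⟩
    exact smul_decomp c h k

/-- The component `h` of `h + ik ∈ K + iK`, with `h, k ∈ K`. -/
def rePart (x : K.tomitaDomain) : 𝓗 := x.2.choose

/-- The component `k` of `h + ik ∈ K + iK`, with `h, k ∈ K`. -/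
def imPart (x : K.tomitaDomain) : 𝓗 := x.2.choose_spec.2.choose

theorem rePart_mem (x : K.tomitaDomain) : K.rePart x ∈ K.toClosedSubmodule.toSubmodule :=
  x.2.choose_spec.1

theorem imPart_mem (x : K.tomitaDomain) : K.imPart x ∈ K.toClosedSubmodule.toSubmodule :=
  x.2.choose_spec.2.choose_spec.1

theorem rePart_add_imPart (x : K.tomitaDomain) : (x : 𝓗) = K.rePart x + I • K.imPart x :=
  x.2.choose_spec.2.choose_spec.2

theorem parts_eq {x : K.tomitaDomain} {h k : 𝓗} (hh : h ∈ K.toClosedSubmodule.toSubmodule)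
    (hk : k ∈ K.toClosedSubmodule.toSubmodule) (e : (x : 𝓗) = h + I • k) :
    K.rePart x = h ∧ K.imPart x = k :=
  K.decomp_unique (K.rePart_mem x) (K.imPart_mem x) hh hk ((K.rePart_add_imPart x).symm.trans e)

/-- The Tomita operator `S : h + ik ↦ h - ik` (`h, k ∈ K`), an antilinear operator with domain
`K + iK`. -/
def tomita : 𝓗 →ₛₗ.[starRingEnd ℂ] 𝓗 where
  domain := K.tomitaDomain
  toFun :=
    { toFun := fun x => K.rePart x - I • K.imPart x
      map_add' := fun x y => by
        obtain ⟨h1, h2⟩ := K.parts_eq (x := x + y) (add_mem (K.rePart_mem x) (K.rePart_mem y))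
          (add_mem (K.imPart_mem x) (K.imPart_mem y)) (by
            rw [Submodule.coe_add, K.rePart_add_imPart x, K.rePart_add_imPart y, smul_add]
            abel)
        rw [h1, h2, smul_add]
        abel
      map_smul' := fun c x => by
        obtain ⟨h1, h2⟩ := K.parts_eq (x := c • x)
          (sub_mem (Submodule.smul_mem _ c.re (K.rePart_mem x))
            (Submodule.smul_mem _ c.im (K.imPart_mem x)))
          (add_mem (Submodule.smul_mem _ c.re (K.imPart_mem x))
            (Submodule.smul_mem _ c.im (K.rePart_mem x))) (by
            rw [Submodule.coe_smul, K.rePart_add_imPart x, smul_decomp])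
        rw [h1, h2, sub_eq_add_neg (K.rePart x), ← smul_neg, smul_decomp]
        simp only [conj_re, conj_im, smul_neg, neg_smul, smul_add]
        abel }

/-- The graph of the modular operator `Δ = S* S`, where the adjoint of the antilinear operator `S` is
given by `⟨S* y, z⟩ = ⟨S z, y⟩`. -/
def modularGraph : Submodule ℂ (𝓗 × 𝓗) where
  carrier := {p | ∃ x : K.tomita.domain, (x : 𝓗) = p.1 ∧
    ∀ z : K.tomita.domain, ⟪p.2, (z : 𝓗)⟫_ℂ = ⟪K.tomita z, K.tomita x⟫_ℂ}
  zero_mem' := ⟨0, rfl, fun z => by simp⟩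
  add_mem' := by
    rintro p q ⟨x, hx, h⟩ ⟨y, hy, h'⟩
    refine ⟨x + y, by simp [hx, hy], fun z => ?_⟩
    rw [LinearPMap.map_add, inner_add_right, ← h, ← h', ← inner_add_left]
    rfl
  smul_mem' := by
    rintro c p ⟨x, hx, h⟩
    refine ⟨c • x, by simp [hx], fun z => ?_⟩
    rw [LinearPMap.map_smulₛₗ, inner_smul_right, ← h, ← inner_smul_left]
    rfl

/-- As `K + iK` is dense, the value of `S* S` at a vector is unique. -/
theorem modularGraph_single_valued (p : 𝓗 × 𝓗) (hp : p ∈ K.modularGraph) (h0 : p.1 = 0) :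
    p.2 = 0 := by
  obtain ⟨x, hx, h⟩ := hp
  obtain rfl : x = 0 := Subtype.ext (hx.trans h0)
  let L : ClosedSubmodule ℝ 𝓗 :=
    { carrier := {z | (⟪p.2, z⟫_ℂ).re = 0}
      zero_mem' := by simp
      add_mem' := fun ha hb => by
        simp only [Set.mem_ofPred_eq] at ha hb ⊢
        rw [inner_add_right, Complex.add_re, ha, hb, add_zero]
      smul_mem' := fun c z hz => by
        simp only [Set.mem_ofPred_eq] at hz ⊢
        rw [← Complex.coe_smul, inner_smul_right, Complex.re_ofReal_mul, hz, mul_zero]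
      isClosed' := isClosed_eq (by fun_prop) continuous_const }
  have hS : ∀ z ∈ K.tomitaDomain, z ∈ L := fun z hz => by
    have := h ⟨z, hz⟩
    rw [LinearPMap.map_zero, inner_zero_right] at this
    change (⟪p.2, z⟫_ℂ).re = 0
    rw [this, Complex.zero_re]
  have h1 : K.toClosedSubmodule ≤ L := fun z hz =>
    hS z ⟨z, hz, 0, zero_mem _, by simp⟩
  have h2 : K.toClosedSubmodule.mulI ≤ L := fun z hz => by
    rw [ClosedSubmodule.mem_mapEquiv_iff] at hz
    exact hS z ⟨0, zero_mem _, _, hz, by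
      rw [zero_add]; exact (smul_inv_smul UnitI z).symm⟩
  have h3 : p.2 ∈ L := by
    have h4 : (⊤ : ClosedSubmodule ℝ 𝓗) ≤ L := K.IsCyclic ▸ sup_le h1 h2
    exact h4 (trivial : p.2 ∈ (⊤ : Set 𝓗))
  exact inner_self_eq_zero.1 (Complex.ext h3 (inner_self_im (𝕜 := ℂ) p.2))

/-- The modular operator `Δ = S* S` of the standard subspace `K`; in the polar decomposition
`S = J Δ^{1/2}` of the Tomita operator, `Δ^{1/2}` is the modulus of `S`. -/
def modularOperator : 𝓗 →ₗ.[ℂ] 𝓗 :=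
  K.modularGraph.toLinearPMap

/-- `f(Δ)` for the modular operator `Δ` of `K`. As `Δ` is positive and non-singular, only the values
of `f` on `(0, ∞)` matter. -/
def modularCalculus [CompleteSpace 𝓗] (f : ℝ → ℂ) : 𝓗 →ₗ.[ℂ] 𝓗 :=
  borelCalculus K.modularOperator f

/-- The unitary `Δ^{is}`. -/
def modularPow [CompleteSpace 𝓗] (s : ℝ) : 𝓗 →ₗ.[ℂ] 𝓗 :=
  K.modularCalculus fun t => (t : ℂ) ^ (I * s)

/-- The self-adjoint operator `log Δ`. -/
def logModular [CompleteSpace 𝓗] : 𝓗 →ₗ.[ℂ] 𝓗 :=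
  K.modularCalculus fun t => (Real.log t : ℂ)

/-- A standard subspace is factorial if `K ∩ K' = {0}`, with `K'` its symplectic complement. -/
def IsFactorial : Prop :=
  K.toClosedSubmodule ⊓ K.toClosedSubmodule.symplComp = ⊥

/-- The (algebraic, not closed) sum `K + K'`. -/
def sumSymplComp : Submodule ℝ 𝓗 :=
  K.toClosedSubmodule.toSubmodule ⊔ K.toClosedSubmodule.symplComp.toSubmodule

end StandardSubspace

end

/-! ### Integration against a projection-valued measure: isometry, change of density,
multiplicativity. -/

noncomputable section

/-! The algebraic core is Ran(1 - Δ) ⊆ K + K'. If u = h + ik (h, k ∈ K) lies in Dom Δ, then u + Su =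
2h ∈ K, while Su + Δu ∈ K': for y ∈ K, Sy = y gives ⟨Δu, y⟩ = ⟨y, Su⟩, so ⟨y, Su + Δu⟩ is a number
plus its conjugate. Subtracting, u - Δu ∈ K + K' (`sub_mem_sumSymplComp`).

If f = O(λ - 1) at 1, then g = f/(1 - λ) is bounded near 1 and dominated by a multiple of |f|
elsewhere. Hence every k ∈ Dom f(Δ) lies in Dom g(Δ), and f(Δ)k = (1 - Δ)g(Δ)k
(`mem_sumSymplComp_of_isBigO`). The functions 1 - λ^{is} and log λ vanish at 1 and are
differentiable there.

The bulk of the work shows that Δ has a spectral measure, without which `borelCalculus` returns its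
default value. Real orthogonal projection onto K gives (1 + Δ)⁻¹ explicitly as a bounded
self-adjoint T (`exists_resolvent`). The continuous functional calculus of T and the Riesz–Markov
theorem give spectral projections of T; transported by t ↦ t⁻¹ - 1 they form a measure E with T = ∫
(1 + λ)⁻¹ dE, whence Δ = ∫ λ dE (`exists_integral_eq_modularOperator`). The multiplicativity rule
`HasIntegral.comp` serves twice: to identify ∫ λ dE with Δ, and to factor f(Δ). -/

theorem MeasureTheory.MemLp.tendsto_eLpNorm {α F : Type*} [MeasurableSpace α]
    [NormedAddCommGroup F] {μ : Measure α} {p : ℝ≥0∞} (hp : 1 ≤ p) {f : α → F} (hf : MemLp f p μ)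
    {g : ℕ → α → F} (hg : ∀ n, AEStronglyMeasurable (g n) μ)
    (h : Tendsto (fun n => eLpNorm (f - g n) p μ) atTop (𝓝 0)) :
    Tendsto (fun n => eLpNorm (g n) p μ) atTop (𝓝 (eLpNorm f p μ)) := by
  refine tendsto_of_tendsto_of_tendsto_of_le_of_le
    (g := fun n => eLpNorm f p μ - eLpNorm (f - g n) p μ)
    (h := fun n => eLpNorm f p μ + eLpNorm (f - g n) p μ) ?_ ?_ ?_ ?_
  · simpa using ENNReal.Tendsto.sub tendsto_const_nhds h (Or.inl hf.2.ne)
  · simpa using h.const_add (eLpNorm f p μ)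
  · intro n
    refine tsub_le_iff_right.2 ?_
    simpa using eLpNorm_add_le (hg n) (hf.1.sub (hg n)) hp
  · intro n
    simpa using eLpNorm_sub_le hf.1 (hf.1.sub (hg n)) hp

/-- `L²` convergence implies convergence of integrals for finite measures. -/
theorem MeasureTheory.MemLp.tendsto_integral {α F : Type*} [MeasurableSpace α]
    [NormedAddCommGroup F] [NormedSpace ℝ F] {μ : Measure α} [IsFiniteMeasure μ] {f : α → F}
    (hf : MemLp f 2 μ) {g : ℕ → α → F} (hg : ∀ n, Integrable (g n) μ)
    (h : Tendsto (fun n => eLpNorm (f - g n) 2 μ) atTop (𝓝 0)) :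
    Tendsto (fun n => ∫ t, g n t ∂μ) atTop (𝓝 (∫ t, f t ∂μ)) := by
  refine tendsto_integral_of_L1' _ hf.1 (Eventually.of_forall hg) ?_
  refine tendsto_of_tendsto_of_tendsto_of_le_of_le tendsto_const_nhds
    (h := fun n => eLpNorm (f - g n) 2 μ *
      (μ Set.univ) ^ (1 / (1 : ℝ≥0∞).toReal - 1 / (2 : ℝ≥0∞).toReal))
    ?_ (fun _ => zero_le) fun n => ?_
  · simpa using ENNReal.Tendsto.mul_const h (Or.inr (by finiteness))
  · rw [eLpNorm_sub_comm]
    exact eLpNorm_le_eLpNorm_mul_rpow_measure_univ (by norm_num) (hf.1.sub (hg n).1)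

namespace ProjValuedMeasure

variable {𝓗 : Type*} [NormedAddCommGroup 𝓗] [InnerProductSpace ℂ 𝓗] [CompleteSpace 𝓗]
  {E : ProjValuedMeasure 𝓗}

theorem exists_hasIntegral (E : ProjValuedMeasure 𝓗) {f : ℝ → ℂ} {x : 𝓗}
    (hf : MemLp f 2 (E.scalarMeasure x)) : ∃ y, E.HasIntegral f x y := by
  obtain ⟨p, hp, rfl⟩ := (E.mem_integral_domain f x).2 hf
  exact ⟨p.2, hp⟩

theorem hasIntegral_integral (E : ProjValuedMeasure 𝓗) (f : ℝ → ℂ) (x : (E.integral f).domain) :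
    E.HasIntegral f x (E.integral f x) :=
  Submodule.mem_graph_toLinearPMap (E.integralGraph_single_valued f) x

theorem integral_graph (E : ProjValuedMeasure 𝓗) (f : ℝ → ℂ) :
    (E.integral f).graph = E.integralGraph f :=
  Submodule.toLinearPMap_graph_eq _ (E.integralGraph_single_valued f)

instance (x : 𝓗) : IsFiniteMeasure (E.scalarMeasure x) :=
  ⟨by rw [E.scalarMeasure_apply x MeasurableSet.univ]; exact ENNReal.ofReal_lt_top⟩

/-- The isometry known for simple functions passes to L² limits. -/
theorem HasIntegral.enorm_eq {f : ℝ → ℂ} {x y : 𝓗} (h : E.HasIntegral f x y) :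
    ‖y‖ₑ = eLpNorm f 2 (E.scalarMeasure x) := by
  obtain ⟨hf, s, hs, hy⟩ := h
  refine tendsto_nhds_unique hy.enorm ?_
  simp_rw [← E.eLpNorm_simpleFunc]
  exact hf.tendsto_eLpNorm (by norm_num) (fun n => (s n).aestronglyMeasurable) hs

theorem HasIntegral.sub_fun {f g : ℝ → ℂ} {x y z : 𝓗} (hf : E.HasIntegral f x y)
    (hg : E.HasIntegral g x z) : E.HasIntegral (f - g) x (y - z) := by
  obtain ⟨mf, s, hs, hy⟩ := hf
  obtain ⟨mg, t, ht, hz⟩ := hg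
  refine ⟨mf.sub mg, fun n => s n - t n, ?_, ?_⟩
  · refine tendsto_of_tendsto_of_tendsto_of_le_of_le tendsto_const_nhds
      (by simpa using hs.add ht) (fun _ => zero_le) fun n => ?_
    have : f - g - ⇑(s n - t n) = (f - ⇑(s n)) - (g - ⇑(t n)) := by
      ext u; simp; ring
    rw [this]
    exact eLpNorm_sub_le (mf.1.sub (s n).aestronglyMeasurable)
      (mg.1.sub (t n).aestronglyMeasurable) (by norm_num)
  · simpa only [E.simpleIntegral_sub, _root_.sub_apply] using hy.sub hz

theorem hasIntegral_simpleFunc (s : SimpleFunc ℝ ℂ) (x : 𝓗) :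
    E.HasIntegral s x (E.simpleIntegral s x) :=
  ⟨(s.memLp_of_isFiniteMeasure _ _), fun _ => s, by simp, tendsto_const_nhds⟩

theorem HasIntegral.unique {f : ℝ → ℂ} {x y z : 𝓗} (h : E.HasIntegral f x y)
    (h' : E.HasIntegral f x z) : y = z := by
  obtain ⟨-, s, hs, hy⟩ := h'
  exact tendsto_nhds_unique (h.tendsto hs) hy

theorem HasIntegral.congr {f g : ℝ → ℂ} {x y : 𝓗} (h : E.HasIntegral f x y)
    (hfg : f =ᵐ[E.scalarMeasure x] g) : E.HasIntegral g x y := by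
  obtain ⟨mf, s, hs, hy⟩ := h
  refine ⟨mf.ae_eq hfg, s, ?_, hy⟩
  refine hs.congr fun n => eLpNorm_congr_ae ?_
  filter_upwards [hfg] with t ht
  simp [ht]

/-- The integral is continuous for `L²` convergence of the integrands. -/
theorem HasIntegral.tendsto_of_tendsto {f : ℝ → ℂ} {x y : 𝓗} (h : E.HasIntegral f x y)
    {g : ℕ → ℝ → ℂ} {z : ℕ → 𝓗} (hg : ∀ n, E.HasIntegral (g n) x (z n))
    (hlim : Tendsto (fun n => eLpNorm (f - g n) 2 (E.scalarMeasure x)) atTop (𝓝 0)) :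
    Tendsto z atTop (𝓝 y) := by
  have : Tendsto (fun n => y - z n) atTop (𝓝 0) := by
    rw [tendsto_zero_iff_enorm_tendsto_zero]
    exact hlim.congr fun n => ((h.sub_fun (hg n)).enorm_eq).symm
  simpa using (tendsto_const_nhds (x := y)).sub this

/-- The operator-valued set function whose elementary integral is `simpleIntegral`. -/
def projSMul (E : ProjValuedMeasure 𝓗) (B : Set ℝ) : ℂ →L[ℝ] (𝓗 →L[ℂ] 𝓗) :=
  ((ContinuousLinearMap.id ℂ ℂ).smulRight (E.proj B)).restrictScalars ℝ

theorem simpleIntegral_add (s t : SimpleFunc ℝ ℂ) :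
    E.simpleIntegral (s + t) = E.simpleIntegral s + E.simpleIntegral t := by
  have h := E.simpleIntegral_sub (s + t) t
  rw [add_sub_cancel_right] at h
  rw [h, sub_add_cancel]

theorem simpleIntegral_piecewise {B : Set ℝ} (hB : MeasurableSet B) (c : ℂ) :
    E.simpleIntegral (SimpleFunc.piecewise B hB (SimpleFunc.const ℝ c) (SimpleFunc.const ℝ 0)) =
      c • E.proj B :=
  SimpleFunc.setToSimpleFunc_indicator E.projSMul
    (by ext c : 1; simp [projSMul, E.proj_empty]) hB c

theorem hasIntegral_const (c : ℂ) (x : 𝓗) : E.HasIntegral (fun _ => c) x (c • x) := by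
  have h := E.hasIntegral_simpleFunc (SimpleFunc.piecewise Set.univ MeasurableSet.univ
    (SimpleFunc.const ℝ c) (SimpleFunc.const ℝ 0)) x
  rw [simpleIntegral_piecewise, E.proj_univ] at h
  refine h.congr (Eventually.of_forall fun t => ?_)
  simp

theorem simpleIntegral_mul (s t : SimpleFunc ℝ ℂ) :
    E.simpleIntegral s * E.simpleIntegral t = E.simpleIntegral (s * t) := by
  induction s using SimpleFunc.induction with
  | @const c B hB =>
    induction t using SimpleFunc.induction with
    | @const d C hC =>
      have : SimpleFunc.piecewise B hB (SimpleFunc.const ℝ c) (SimpleFunc.const ℝ 0) *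
          SimpleFunc.piecewise C hC (SimpleFunc.const ℝ d) (SimpleFunc.const ℝ 0) =
          SimpleFunc.piecewise (B ∩ C) (hB.inter hC) (SimpleFunc.const ℝ (c * d))
            (SimpleFunc.const ℝ 0) := by
        ext t
        by_cases h1 : t ∈ B <;> by_cases h2 : t ∈ C <;> simp [h1, h2]
      rw [this, simpleIntegral_piecewise, simpleIntegral_piecewise, simpleIntegral_piecewise,
        smul_mul_smul_comm, E.proj_inter B C hB hC]
    | add _ ht ht' => rw [mul_add, simpleIntegral_add, simpleIntegral_add, mul_add, ht, ht']
  | add _ hs hs' => rw [add_mul, simpleIntegral_add, simpleIntegral_add, add_mul, hs, hs']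

theorem HasIntegral.inner_self {f : ℝ → ℂ} {x y : 𝓗} (h : E.HasIntegral f x y) :
    ⟪x, y⟫_ℂ = ∫ t, f t ∂E.scalarMeasure x := by
  obtain ⟨mf, s, hs, hy⟩ := h
  have h1 : ∀ n, ⟪x, E.simpleIntegral (s n) x⟫_ℂ = ∫ t, s n t ∂E.scalarMeasure x := by
    intro n
    rw [SimpleFunc.integral_eq_sum _ ((s n).integrable_of_isFiniteMeasure)]
    simp only [simpleIntegral, _root_.sum_apply, _root_.smul_apply, inner_sum, inner_smul_right]
    refine Finset.sum_congr rfl fun c _ => ?_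
    have h2 : ⟪x, E.proj (s n ⁻¹' {c}) x⟫_ℂ = ((‖E.proj (s n ⁻¹' {c}) x‖ ^ 2 : ℝ) : ℂ) := by
      have := E.inner_proj_proj ((s n).measurableSet_fiber c) ((s n).measurableSet_fiber c) x x
      rw [Set.inter_self, inner_self_eq_norm_sq_to_K] at this
      simp [← this]
    rw [h2, measureReal_def, E.scalarMeasure_apply _ ((s n).measurableSet_fiber c),
      ENNReal.toReal_ofReal (by positivity), Complex.real_smul, mul_comm]
  have h3 : Tendsto (fun n => ⟪x, E.simpleIntegral (s n) x⟫_ℂ) atTop (𝓝 ⟪x, y⟫_ℂ) :=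
    tendsto_const_nhds.inner hy
  simp_rw [h1] at h3
  exact tendsto_nhds_unique h3
    (mf.tendsto_integral (fun n => (s n).integrable_of_isFiniteMeasure) hs)

/-- A simple function is bounded, so multiplying by it preserves L² convergence of the
approximations of g. -/
theorem HasIntegral.simpleIntegral {g : ℝ → ℂ} {x u : 𝓗} (h : E.HasIntegral g x u)
    (s : SimpleFunc ℝ ℂ) : E.HasIntegral (⇑s * g) x (E.simpleIntegral s u) := by
  obtain ⟨mg, t, ht, hu⟩ := h
  obtain ⟨C, hC⟩ := s.exists_forall_norm_le
  have hb : ∀ f : ℝ → ℂ, eLpNorm (⇑s * f) 2 (E.scalarMeasure x) ≤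
      ENNReal.ofReal C * eLpNorm f 2 (E.scalarMeasure x) := fun f => by
    refine eLpNorm_le_mul_eLpNorm_of_ae_le_mul (Eventually.of_forall fun r => ?_) 2
    simpa using mul_le_mul_of_nonneg_right (hC r) (norm_nonneg (f r))
  refine ⟨⟨s.aestronglyMeasurable.mul mg.1, (hb g).trans_lt ?_⟩, fun n => s * t n, ?_, ?_⟩
  · exact ENNReal.mul_lt_top ENNReal.ofReal_lt_top mg.2
  · refine tendsto_of_tendsto_of_tendsto_of_le_of_le tendsto_const_nhds
      (by
        simpa using ENNReal.Tendsto.const_mul (a := ENNReal.ofReal C) ht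
          (Or.inr ENNReal.ofReal_ne_top)) (fun _ => zero_le) fun n => ?_
    rw [SimpleFunc.coe_mul, ← mul_sub]
    exact hb _
  · simp_rw [← simpleIntegral_mul]
    exact ((E.simpleIntegral s).continuous.tendsto u).comp hu

/-- E(B)u is the integral of 1_B g at x, so by the isometry ‖E(B)u‖² is the integral of |g|² over B.
-/
theorem HasIntegral.scalarMeasure_eq {g : ℝ → ℂ} {x u : 𝓗} (h : E.HasIntegral g x u) :
    E.scalarMeasure u = (E.scalarMeasure x).withDensity (fun t => ‖g t‖ₑ ^ 2) := by
  ext B hB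
  have h1 := (h.simpleIntegral
    (SimpleFunc.piecewise B hB (SimpleFunc.const ℝ 1) (SimpleFunc.const ℝ 0))).enorm_eq
  rw [simpleIntegral_piecewise hB, one_smul] at h1
  rw [E.scalarMeasure_apply u hB, withDensity_apply _ hB, ENNReal.ofReal_pow (norm_nonneg _),
    ofReal_norm, h1, eLpNorm_eq_lintegral_rpow_enorm_toReal (by norm_num) (by norm_num),
    ← lintegral_indicator hB, ← ENNReal.rpow_natCast, ← ENNReal.rpow_mul]
  norm_num
  congr 1 with t
  by_cases ht : t ∈ B <;> simp [ht]

theorem HasIntegral.eLpNorm_eq {g : ℝ → ℂ} {x u : 𝓗} (h : E.HasIntegral g x u) (f : ℝ → ℂ) :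
    eLpNorm f 2 (E.scalarMeasure u) = eLpNorm (f * g) 2 (E.scalarMeasure x) := by
  rw [eLpNorm_eq_lintegral_rpow_enorm_toReal (by norm_num) (by norm_num),
    eLpNorm_eq_lintegral_rpow_enorm_toReal (by norm_num) (by norm_num), h.scalarMeasure_eq,
    lintegral_withDensity_eq_lintegral_mul_non_measurable₀ _ (h.1.1.enorm.pow_const 2)
      (Eventually.of_forall fun t => by finiteness)]
  congr 1
  refine lintegral_congr fun t => ?_
  simp [enorm_mul, mul_pow, mul_comm]

/-- Multiplicativity of the integral. -/
theorem HasIntegral.comp {f g : ℝ → ℂ} (hfm : Measurable f) {x u z : 𝓗} (h : E.HasIntegral g x u)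
    (h' : E.HasIntegral (f * g) x z) : E.HasIntegral f u z := by
  have mf : MemLp f 2 (E.scalarMeasure u) :=
    ⟨hfm.aestronglyMeasurable, by rw [h.eLpNorm_eq]; exact h'.1.2⟩
  obtain ⟨t, ht⟩ := exists_approx mf
  -- Since the measure of u is |g|² times that of x, tₙ → f in L² for u says exactly that tₙg → fg
  -- in L² for x.
  refine ⟨mf, t, ht, h'.tendsto_of_tendsto (fun n => h.simpleIntegral (t n)) ?_⟩
  refine ht.congr fun n => ?_
  rw [h.eLpNorm_eq, sub_mul]

end ProjValuedMeasure
end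

/-! ### Spectral projections of a representation of C(X, ℝ). -/

noncomputable section

theorem MeasureTheory.memLp_indicator_one {X : Type*} [MeasurableSpace X] {A : Set X}
    (hA : MeasurableSet A) (ν : Measure X) [IsFiniteMeasure ν] :
    MemLp (A.indicator (1 : X → ℝ)) 2 ν :=
  memLp_indicator_const 2 hA 1 (Or.inr (measure_ne_top ν A))

namespace StarAlgHom

open scoped CompactlySupported

section

variable {X : Type*} [TopologicalSpace X] [MeasurableSpace X]

/-- The continuous functions `f n` converge in `L²(ν)` to the indicator function of `A`. -/
def ApproxIndicator (A : Set X) (ν : Measure X) (f : ℕ → C(X, ℝ)) : Prop :=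
  Tendsto (fun n => eLpNorm (A.indicator 1 - ⇑(f n)) 2 ν) atTop (𝓝 0)

theorem ApproxIndicator.mono {A : Set X} {μ ν : Measure X} {f : ℕ → C(X, ℝ)}
    (h : ApproxIndicator A ν f) (hle : μ ≤ ν) : ApproxIndicator A μ f :=
  tendsto_of_tendsto_of_tendsto_of_le_of_le tendsto_const_nhds h (fun _ => zero_le)
    fun _ => eLpNorm_mono_measure _ hle

end

variable {𝓗 : Type*} [NormedAddCommGroup 𝓗] [InnerProductSpace ℂ 𝓗] [CompleteSpace 𝓗]
  {X : Type*} [TopologicalSpace X] (π : C(X, ℝ) →⋆ₐ[ℝ] (𝓗 →L[ℂ] 𝓗))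

theorem inner_map_map (f g : C(X, ℝ)) (x y : 𝓗) :
    ⟪π f x, π g y⟫_ℂ = ⟪x, π (f * g) y⟫_ℂ := by
  have h : star (π f) = π f := by rw [← map_star, star_trivial]
  rw [← ContinuousLinearMap.adjoint_inner_right, ← ContinuousLinearMap.star_eq_adjoint, h, map_mul]
  rfl

theorem inner_map_eq_ofReal (f : C(X, ℝ)) (x : 𝓗) :
    ⟪x, π f x⟫_ℂ = ((⟪x, π f x⟫_ℂ).re : ℂ) := by
  have h := π.inner_map_map f 1 x x
  rw [map_one, mul_one] at h
  refine (Complex.conj_eq_iff_re.1 ?_).symm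
  rw [inner_conj_symm]
  exact h

variable [CompactSpace X]

/-- The vector state of `x`, as a positive functional on continuous functions. -/
def vectorState (x : 𝓗) : C_c(X, ℝ) →ₚ[ℝ] ℝ :=
  PositiveLinearMap.mk₀
    { toFun := fun f => (⟪x, π f.toContinuousMap x⟫_ℂ).re
      map_add' := fun f g => by
        have : (f + g).toContinuousMap = f.toContinuousMap + g.toContinuousMap := rfl
        rw [this, map_add, _root_.add_apply, inner_add_right, Complex.add_re]
      map_smul' := fun c f => by
        have : (c • f).toContinuousMap = c • f.toContinuousMap := rfl
        rw [this, map_smul, _root_.smul_apply, ← Complex.coe_smul, inner_smul_right,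
          Complex.re_ofReal_mul]
        rfl }
    (fun f hf => by
      -- Positivity: f = g² with g = √f, so the state takes the value ‖π(g)x‖².
      let g : C(X, ℝ) := ⟨fun t => Real.sqrt (f t), by fun_prop⟩
      have hg : f.toContinuousMap = g * g := by
        ext t
        exact (Real.mul_self_sqrt (hf t)).symm
      change 0 ≤ (⟪x, π f.toContinuousMap x⟫_ℂ).re
      rw [hg, ← inner_map_map]
      exact inner_self_nonneg (𝕜 := ℂ))

variable [MeasurableSpace X] [BorelSpace X]

theorem ApproxIndicator.tendsto_integral {A : Set X} (hA : MeasurableSet A) {ν : Measure X}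
    [IsFiniteMeasure ν] {f : ℕ → C(X, ℝ)} (hf : ApproxIndicator A ν f) :
    Tendsto (fun n => ∫ t, f n t ∂ν) atTop (𝓝 (ν.real A)) := by
  rw [← integral_indicator_one hA]
  exact (memLp_indicator_one hA ν).tendsto_integral
    (fun n => (map_continuous (f n)).integrable_of_hasCompactSupport
      (HasCompactSupport.of_compactSpace _)) hf

variable [T2Space X]

/-- The spectral measure of the vector `x`. -/
def vectorMeasure (x : 𝓗) : Measure X := RealRMK.rieszMeasure (π.vectorState x)

instance (x : 𝓗) : IsFiniteMeasure (π.vectorMeasure x) := by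
  unfold vectorMeasure; infer_instance

theorem re_inner_eq_integral (f : C(X, ℝ)) (x : 𝓗) :
    (⟪x, π f x⟫_ℂ).re = ∫ t, f t ∂π.vectorMeasure x := by
  let f' : C_c(X, ℝ) := ⟨f, HasCompactSupport.of_compactSpace _⟩
  exact (RealRMK.integral_rieszMeasure (π.vectorState x) f').symm

theorem inner_eq_integral (f : C(X, ℝ)) (x : 𝓗) :
    ⟪x, π f x⟫_ℂ = ((∫ t, f t ∂π.vectorMeasure x : ℝ) : ℂ) := by
  rw [inner_map_eq_ofReal, re_inner_eq_integral]

theorem vectorMeasure_univ (x : 𝓗) :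
    π.vectorMeasure x Set.univ = ENNReal.ofReal (‖x‖ ^ 2) := by
  have h := π.re_inner_eq_integral 1 x
  rw [map_one, one_apply_eq_self] at h
  have h2 := inner_self_eq_norm_sq (𝕜 := ℂ) x
  rw [RCLike.re_to_complex, h] at h2
  rw [← h2]
  simp

theorem enorm_map_eq_eLpNorm (f : C(X, ℝ)) (x : 𝓗) :
    ‖π f x‖ₑ = eLpNorm f 2 (π.vectorMeasure x) := by
  have h1 : ‖π f x‖ ^ 2 = ∫ t, f t ^ 2 ∂π.vectorMeasure x := by
    rw [← inner_self_eq_norm_sq (𝕜 := ℂ), inner_map_map, RCLike.re_to_complex,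
      re_inner_eq_integral]
    simp [sq]
  have hi : Integrable (fun t => f t ^ 2) (π.vectorMeasure x) :=
    (map_continuous (f ^ 2)).integrable_of_hasCompactSupport (HasCompactSupport.of_compactSpace _)
  have h2 : eLpNorm f 2 (π.vectorMeasure x) ^ 2 = ‖π f x‖ₑ ^ 2 := by
    rw [← ofReal_norm, ← ENNReal.ofReal_pow (norm_nonneg _), h1,
      ofReal_integral_eq_lintegral_ofReal hi (Eventually.of_forall fun t => sq_nonneg _),
      eLpNorm_eq_lintegral_rpow_enorm_toReal (by norm_num) (by norm_num),
      ← ENNReal.rpow_natCast, ← ENNReal.rpow_mul]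
    norm_num
    refine lintegral_congr fun t => ?_
    rw [← ofReal_norm, ← ENNReal.ofReal_pow (norm_nonneg _), Real.norm_eq_abs, sq_abs]
  exact ((ENNReal.pow_right_strictMono two_ne_zero).injective h2).symm

theorem exists_approxIndicator [TopologicalSpace.PseudoMetrizableSpace X] {A : Set X}
    (hA : MeasurableSet A) (ν : Measure X) [IsFiniteMeasure ν] :
    ∃ f, ApproxIndicator A ν f := by
  have h : ∀ n : ℕ, ∃ g : C(X, ℝ), eLpNorm (A.indicator 1 - ⇑g) 2 ν ≤ ((n : ℝ≥0∞) + 1)⁻¹ := by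
    intro n
    obtain ⟨g, hg, -⟩ := (memLp_indicator_one hA ν).exists_boundedContinuous_eLpNorm_sub_le
      (by norm_num) (ε := ((n : ℝ≥0∞) + 1)⁻¹) (by simp)
    exact ⟨g.toContinuousMap, hg⟩
  choose f hf using h
  refine ⟨f, tendsto_of_tendsto_of_tendsto_of_le_of_le tendsto_const_nhds ?_
    (fun _ => zero_le) hf⟩
  simpa using (tendsto_add_atTop_iff_nat 1).2 ENNReal.tendsto_inv_nat_nhds_zero

theorem enorm_map_sub_le {A : Set X} (hA : MeasurableSet A) (f g : C(X, ℝ)) (x : 𝓗) :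
    ‖π f x - π g x‖ₑ ≤ eLpNorm (A.indicator 1 - ⇑g) 2 (π.vectorMeasure x) +
      eLpNorm (A.indicator 1 - ⇑f) 2 (π.vectorMeasure x) := by
  rw [← _root_.sub_apply, ← map_sub, enorm_map_eq_eLpNorm]
  have : (⇑(f - g) : X → ℝ) = (A.indicator 1 - ⇑g) - (A.indicator 1 - ⇑f) := by
    ext u; simp
  rw [this]
  have hm := (memLp_indicator_one hA (π.vectorMeasure x)).1
  exact eLpNorm_sub_le (hm.sub (map_continuous g).aestronglyMeasurable)
    (hm.sub (map_continuous f).aestronglyMeasurable) (by norm_num)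

/-- The limit is the same for all approximating sequences. This lets one sequence serve several
vectors at once when linearity is checked. -/
theorem exists_forall_tendsto [TopologicalSpace.PseudoMetrizableSpace X] {A : Set X}
    (hA : MeasurableSet A) (x : 𝓗) :
    ∃ y, ∀ f, ApproxIndicator A (π.vectorMeasure x) f →
      Tendsto (fun n => π (f n) x) atTop (𝓝 y) := by
  obtain ⟨g, hg⟩ := exists_approxIndicator hA (π.vectorMeasure x)
  have hc : CauchySeq fun n => π (g n) x := by
    refine Metric.cauchySeq_iff.2 fun ε hε => ?_
    obtain ⟨N, hN⟩ := (ENNReal.tendsto_atTop_zero.1 hg) (ENNReal.ofReal (ε / 3))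
      (by simpa using hε)
    refine ⟨N, fun m hm n hn => ?_⟩
    rw [dist_eq_norm, ← ENNReal.ofReal_lt_ofReal_iff hε, ofReal_norm]
    refine ((π.enorm_map_sub_le hA _ _ x).trans (add_le_add (hN n hn) (hN m hm))).trans_lt ?_
    rw [← ENNReal.ofReal_add (by positivity) (by positivity)]
    exact (ENNReal.ofReal_lt_ofReal_iff hε).2 (by linarith)
  obtain ⟨y, hy⟩ := cauchySeq_tendsto_of_complete hc
  refine ⟨y, fun f hf => ?_⟩
  have hlim : Tendsto (fun n => π (f n) x - π (g n) x) atTop (𝓝 0) := by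
    rw [tendsto_zero_iff_enorm_tendsto_zero]
    exact tendsto_of_tendsto_of_tendsto_of_le_of_le tendsto_const_nhds
      (by simpa using! Tendsto.add hg hf) (fun _ => zero_le)
      fun n => π.enorm_map_sub_le hA _ _ x
  simpa using hlim.add hy

/-- P is the strong limit of π(fₙ) as fₙ tends to the indicator of A, the sequence depending on the
vector. An indicator equals its square, so ‖Px‖² = ⟨x, Px⟩, which yields both the bound and the
projection property. -/
theorem exists_proj [TopologicalSpace.PseudoMetrizableSpace X] {A : Set X}
    (hA : MeasurableSet A) :
    ∃ P : 𝓗 →L[ℂ] 𝓗, IsStarProjection P ∧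
      ∀ x, ⟪x, P x⟫_ℂ = ((π.vectorMeasure x).real A : ℂ) := by
  choose p hp using fun x => π.exists_forall_tendsto hA x
  have hinner : ∀ x, ⟪x, p x⟫_ℂ = ((π.vectorMeasure x).real A : ℂ) := fun x => by
    obtain ⟨f, hf⟩ := exists_approxIndicator hA (π.vectorMeasure x)
    have h1 : Tendsto (fun n => ⟪x, π (f n) x⟫_ℂ) atTop (𝓝 ⟪x, p x⟫_ℂ) :=
      tendsto_const_nhds.inner (hp x f hf)
    simp_rw [inner_eq_integral] at h1
    exact tendsto_nhds_unique h1
      ((Complex.continuous_ofReal.tendsto _).comp (hf.tendsto_integral hA))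
  have hnorm : ∀ x, ⟪p x, p x⟫_ℂ = ⟪x, p x⟫_ℂ := fun x => by
    obtain ⟨f, hf⟩ := exists_approxIndicator hA (π.vectorMeasure x)
    have h1 := (hp x f hf).enorm
    simp_rw [enorm_map_eq_eLpNorm] at h1
    have hm := memLp_indicator_one hA (π.vectorMeasure x)
    have h2 := tendsto_nhds_unique h1 (hm.tendsto_eLpNorm (by norm_num)
      (fun n => (map_continuous (f n)).aestronglyMeasurable) hf)
    have h3 : eLpNorm (A.indicator (1 : X → ℝ)) 2 (π.vectorMeasure x) =
        π.vectorMeasure x A ^ (1 / (2 : ℝ)) := by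
      have := eLpNorm_indicator_const (μ := π.vectorMeasure x) (c := (1 : ℝ)) hA (p := 2)
        (by norm_num) (by norm_num)
      simpa using! this
    rw [hinner, inner_self_eq_norm_sq_to_K, ← toReal_enorm, h2, h3, measureReal_def]
    have h4 : (π.vectorMeasure x A ^ (1 / (2 : ℝ))).toReal ^ 2 = (π.vectorMeasure x A).toReal := by
      rw [← ENNReal.toReal_pow, ← ENNReal.rpow_natCast, ← ENNReal.rpow_mul]
      norm_num
    rw [← h4, Complex.ofReal_pow]
    rfl
  let L : 𝓗 →ₗ[ℂ] 𝓗 :=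
    { toFun := p
      map_add' := fun x y => by
        -- Approximating in L² of the sum of the three measures gives convergence for each of them.
        obtain ⟨f, hf⟩ := exists_approxIndicator hA
          (π.vectorMeasure x + π.vectorMeasure y + π.vectorMeasure (x + y))
        refine tendsto_nhds_unique (hp (x + y) f (hf.mono (Measure.le_add_left le_rfl))) ?_
        simp_rw [map_add]
        exact (hp x f (hf.mono (Measure.le_add_right (Measure.le_add_right le_rfl)))).add
          (hp y f (hf.mono (Measure.le_add_right (Measure.le_add_left le_rfl))))
      map_smul' := fun c x => by
        obtain ⟨f, hf⟩ := exists_approxIndicator hA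
          (π.vectorMeasure x + π.vectorMeasure (c • x))
        refine tendsto_nhds_unique (hp (c • x) f (hf.mono (Measure.le_add_left le_rfl))) ?_
        simp_rw [map_smul]
        exact (hp x f (hf.mono (Measure.le_add_right le_rfl))).const_smul c }
  let P : 𝓗 →L[ℂ] 𝓗 := L.mkContinuous 1 fun x => by
    have h1 : ‖p x‖ ^ 2 ≤ ‖x‖ * ‖p x‖ := by
      rw [← inner_self_eq_norm_sq (𝕜 := ℂ), hnorm]
      exact re_inner_le_norm _ _
    rw [one_mul]
    change ‖p x‖ ≤ ‖x‖
    by_contra! h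
    nlinarith [norm_nonneg x, norm_nonneg (p x)]
  have hP : ∀ x, P x = p x := fun _ => rfl
  -- By polarization it suffices to compare quadratic forms. From P*P = P, self-adjointness follows
  -- first, then idempotence.
  have key : star P * P = P := by
    refine ContinuousLinearMap.coe_injective ((ext_inner_map _ _).1 fun x => ?_)
    change ⟪star P (P x), x⟫_ℂ = ⟪P x, x⟫_ℂ
    rw [ContinuousLinearMap.star_eq_adjoint, ContinuousLinearMap.adjoint_inner_left, hP, hnorm,
      ← inner_conj_symm (p x), hinner, Complex.conj_ofReal]
  have hs : IsSelfAdjoint P := by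
    rw [← key]
    exact IsSelfAdjoint.star_mul_self P
  refine ⟨P, ⟨?_, hs⟩, hinner⟩
  rw [hs.star_eq] at key
  exact key

end StarAlgHom
end

/-! ### From quadratic forms to a projection-valued measure; the bounded spectral theorem. -/

noncomputable section

variable {𝓗 : Type*} [NormedAddCommGroup 𝓗] [InnerProductSpace ℂ 𝓗]

theorem ContinuousLinearMap.ext_inner_self {P Q : 𝓗 →L[ℂ] 𝓗}
    (h : ∀ x, ⟪x, P x⟫_ℂ = ⟪x, Q x⟫_ℂ) : P = Q := by
  refine ContinuousLinearMap.coe_injective ((ext_inner_map _ _).1 fun x => ?_)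
  rw [← inner_conj_symm, ← inner_conj_symm _ x]
  exact congrArg _ (h x)

variable [CompleteSpace 𝓗]

theorem IsStarProjection.norm_sq_eq {P : 𝓗 →L[ℂ] 𝓗} (hP : IsStarProjection P) (x : 𝓗) :
    ‖P x‖ ^ 2 = (⟪x, P x⟫_ℂ).re := by
  have h : star P * P = P := by rw [hP.isSelfAdjoint.star_eq]; exact hP.isIdempotentElem
  rw [← inner_self_eq_norm_sq (𝕜 := ℂ), ← ContinuousLinearMap.adjoint_inner_right,
    ← ContinuousLinearMap.star_eq_adjoint]
  conv_rhs => rw [← h]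
  rfl

/-- Expanding (p + q)² gives pq + qp = 0. Multiplying by p on either side gives pq = -pqp = qp, so
2pq = 0; the `Module ℂ R` structure allows division by 2. -/
theorem IsIdempotentElem.mul_eq_zero_of_add {R : Type*} [Ring R] [Module ℂ R] {p q : R}
    (hp : IsIdempotentElem p) (hq : IsIdempotentElem q) (h : IsIdempotentElem (p + q)) :
    p * q = 0 := by
  have h1 : p * q + q * p = 0 := by
    have := h.eq
    rw [add_mul, mul_add, mul_add, hp.eq, hq.eq] at this
    have h2 : p + p * q + (q * p + q) = (p + q) + (p * q + q * p) := by abel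
    rw [h2] at this
    simpa using this
  have h2 : p * q + p * q * p = 0 := by
    have := congrArg (p * ·) h1
    simpa [mul_add, ← mul_assoc, hp.eq] using this
  have h3 : p * q * p + q * p = 0 := by
    have := congrArg (· * p) h1
    simpa [add_mul, mul_assoc, hp.eq] using this
  have h4 : p * q = q * p := by
    rw [eq_neg_of_add_eq_zero_left h2, eq_neg_of_add_eq_zero_right h3]
  rw [← h4] at h1
  rw [← two_smul ℂ] at h1
  exact (smul_eq_zero.1 h1).resolve_left two_ne_zero

/-- A family of measures `μ x` such that each `x ↦ μ x B` is the quadratic form of a projection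
comes from a projection-valued measure. -/
theorem ProjValuedMeasure.exists_scalarMeasure_eq (μ : 𝓗 → Measure ℝ) [∀ x, IsFiniteMeasure (μ x)]
    (huniv : ∀ x, μ x Set.univ = ENNReal.ofReal (‖x‖ ^ 2))
    (hμ : ∀ B, MeasurableSet B → ∃ P : 𝓗 →L[ℂ] 𝓗, IsStarProjection P ∧
      ∀ x, ⟪x, P x⟫_ℂ = ((μ x).real B : ℂ)) :
    ∃ E : ProjValuedMeasure 𝓗, ∀ x, E.scalarMeasure x = μ x := by
  have hμ' : ∀ B, ∃ P : 𝓗 →L[ℂ] 𝓗, MeasurableSet B → IsStarProjection P ∧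
      ∀ x, ⟪x, P x⟫_ℂ = ((μ x).real B : ℂ) := fun B => by
    by_cases hB : MeasurableSet B
    · obtain ⟨P, hP⟩ := hμ B hB
      exact ⟨P, fun _ => hP⟩
    · exact ⟨0, fun h => absurd h hB⟩
  choose P hP using hμ'
  have hproj : ∀ B, MeasurableSet B → IsStarProjection (P B) := fun B hB => (hP B hB).1
  have hin : ∀ B, MeasurableSet B → ∀ x, ⟪x, P B x⟫_ℂ = ((μ x).real B : ℂ) :=
    fun B hB => (hP B hB).2
  have hnorm : ∀ B, MeasurableSet B → ∀ x, ‖P B x‖ ^ 2 = (μ x).real B := fun B hB x => by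
    rw [(hproj B hB).norm_sq_eq, hin B hB, Complex.ofReal_re]
  have hunion : ∀ B C, MeasurableSet B → MeasurableSet C → Disjoint B C →
      P (B ∪ C) = P B + P C := fun B C hB hC hd => by
    refine ContinuousLinearMap.ext_inner_self fun x => ?_
    rw [_root_.add_apply, inner_add_right, hin _ hB, hin _ hC, hin _ (hB.union hC),
      measureReal_union hd hC, Complex.ofReal_add]
  have hdisj : ∀ B C, MeasurableSet B → MeasurableSet C → Disjoint B C → P B * P C = 0 :=
    fun B C hB hC hd =>
      (hproj B hB).isIdempotentElem.mul_eq_zero_of_add (hproj C hC).isIdempotentElem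
        (hunion B C hB hC hd ▸ (hproj _ (hB.union hC)).isIdempotentElem)
  have hfin : ∀ B : ℕ → Set ℝ, (∀ i, MeasurableSet (B i)) →
      Pairwise (Function.onFun Disjoint B) → ∀ s : Finset ℕ,
      P (⋃ i ∈ s, B i) = ∑ i ∈ s, P (B i) := fun B hB hd s => by
    refine ContinuousLinearMap.ext_inner_self fun x => ?_
    rw [hin _ (s.measurableSet_biUnion fun i _ => hB i),
      measureReal_biUnion_finset (fun i _ j _ h => hd h) (fun i _ => hB i), _root_.sum_apply,
      inner_sum, Complex.ofReal_sum]
    exact Finset.sum_congr rfl fun i _ => (hin _ (hB i) x).symm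
  have hsum : ∀ B : ℕ → Set ℝ, (∀ i, MeasurableSet (B i)) →
      Pairwise (Function.onFun Disjoint B) → ∀ x,
      HasSum (fun i => P (B i) x) (P (⋃ i, B i) x) := fun B hB hd x => by
    have hU := MeasurableSet.iUnion hB
    have hm : HasSum (fun i => (μ x).real (B i)) ((μ x).real (⋃ i, B i)) := by
      have h := ENNReal.hasSum_toReal (f := fun i => μ x (B i))
        (by rw [← measure_iUnion hd hB]; exact measure_ne_top _ _)
      rwa [← ENNReal.tsum_toReal_eq (fun i => measure_ne_top _ _), ← measure_iUnion hd hB] at h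
    -- The remainder after finitely many terms is the projection of the leftover set, so its squared
    -- norm is a tail of the scalar measure.
    have hdiff : ∀ s : Finset ℕ, ‖P (⋃ i, B i) x - ∑ i ∈ s, P (B i) x‖ ^ 2 =
        (μ x).real (⋃ i, B i) - ∑ i ∈ s, (μ x).real (B i) := fun s => by
      have hs : MeasurableSet (⋃ i ∈ s, B i) := s.measurableSet_biUnion fun i _ => hB i
      have hsub : (⋃ i ∈ s, B i) ⊆ ⋃ i, B i := Set.iUnion₂_subset_iUnion _ _
      have h1 := hunion _ _ hs (hU.diff hs) Set.disjoint_sdiff_right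
      rw [Set.union_sdiff_cancel hsub, hfin B hB hd] at h1
      rw [h1, _root_.add_apply, _root_.sum_apply, add_sub_cancel_left, hnorm _ (hU.diff hs),
        measureReal_sdiff hsub hs,
        measureReal_biUnion_finset (fun i _ j _ h => hd h) (fun i _ => hB i)]
    have h0 : Tendsto (fun s : Finset ℕ => ‖P (⋃ i, B i) x - ∑ i ∈ s, P (B i) x‖ ^ 2) atTop
        (𝓝 0) := by
      simp_rw [hdiff]
      simpa using (tendsto_const_nhds (x := (μ x).real (⋃ i, B i))).sub hm
    have h1 : Tendsto (fun s : Finset ℕ => P (⋃ i, B i) x - ∑ i ∈ s, P (B i) x) atTop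
        (𝓝 0) := by
      rw [tendsto_zero_iff_norm_tendsto_zero]
      simpa [Function.comp_def, Real.sqrt_sq] using (Real.continuous_sqrt.tendsto 0).comp h0
    simpa [HasSum] using (tendsto_const_nhds (x := P (⋃ i, B i) x)).sub h1
  let E : ProjValuedMeasure 𝓗 :=
    { proj := P
      isStarProjection := hproj
      proj_univ := by
        refine ContinuousLinearMap.ext_inner_self fun x => ?_
        rw [hin _ MeasurableSet.univ, measureReal_def, huniv, one_apply_eq_self,
          inner_self_eq_norm_sq_to_K, ENNReal.toReal_ofReal (by positivity), Complex.ofReal_pow]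
        rfl
      proj_inter := fun B C hB hC => by
        have hBC := hB.inter hC
        -- Splitting B and C along B ∩ C, all cross terms in P(B)P(C) vanish by disjointness.
        have h1 := hunion _ _ hBC (hB.diff hC) Set.disjoint_sdiff_inter.symm
        have h2 := hunion _ _ hBC (hC.diff hB)
          (by rw [Set.inter_comm]; exact Set.disjoint_sdiff_inter.symm)
        rw [Set.inter_union_sdiff] at h1
        rw [Set.inter_comm, Set.inter_union_sdiff, Set.inter_comm] at h2
        rw [h1, h2, add_mul, mul_add, mul_add, hdisj _ _ hBC (hC.diff hB),
          hdisj _ _ (hB.diff hC) hBC, hdisj _ _ (hB.diff hC) (hC.diff hB), add_zero, add_zero,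
          add_zero, (hproj _ hBC).isIdempotentElem.eq]
        · exact disjoint_sdiff_sdiff
        · exact Set.disjoint_sdiff_inter
        · rw [Set.inter_comm]; exact Set.disjoint_sdiff_inter.symm
      hasSum_proj := hsum }
  refine ⟨E, fun x => ?_⟩
  ext B hB
  rw [E.scalarMeasure_apply x hB]
  change ENNReal.ofReal (‖P B x‖ ^ 2) = _
  rw [hnorm B hB, ofReal_measureReal]

/-- The bounded spectral theorem, transported by a Borel function `ψ`. -/
theorem IsSelfAdjoint.exists_projValuedMeasure {T : 𝓗 →L[ℂ] 𝓗} (hT : IsSelfAdjoint T)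
    (φ ψ : ℝ → ℝ) (hφ : Measurable φ) (hψ : Measurable ψ) (hφψ : ∀ t, φ (ψ t) = t) :
    ∃ E : ProjValuedMeasure 𝓗, ∀ x, E.HasIntegral (fun t => (φ t : ℂ)) x (T x) := by
  let π : C(spectrum ℝ T, ℝ) →⋆ₐ[ℝ] (𝓗 →L[ℂ] 𝓗) := cfcHom hT
  have hψ' : Measurable fun t : spectrum ℝ T => ψ t := hψ.comp measurable_subtype_coe
  obtain ⟨E, hE⟩ := ProjValuedMeasure.exists_scalarMeasure_eq
    (fun x => (π.vectorMeasure x).map fun t : spectrum ℝ T => ψ t)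
    (fun x => by rw [Measure.map_apply hψ' MeasurableSet.univ, Set.preimage_univ,
      π.vectorMeasure_univ])
    (fun B hB => by
      obtain ⟨P, hP, h⟩ := π.exists_proj (hψ' hB)
      refine ⟨P, hP, fun x => ?_⟩
      rw [h x, measureReal_def, measureReal_def, Measure.map_apply hψ' hB])
  refine ⟨E, ?_⟩
  have hφ' : Measurable fun t => (φ t : ℂ) := Complex.measurable_ofReal.comp hφ
  have hmem : ∀ x, MemLp (fun t => (φ t : ℂ)) 2 (E.scalarMeasure x) := fun x => by
    rw [hE, memLp_map_measure_iff hφ'.aestronglyMeasurable hψ'.aemeasurable]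
    have : (fun t => (φ t : ℂ)) ∘ (fun t : spectrum ℝ T => ψ t) = fun t : spectrum ℝ T => ((t : ℝ) : ℂ) := by
      ext t; simp [hφψ]
    rw [this]
    have hc : Continuous fun t : spectrum ℝ T => ((t : ℝ) : ℂ) := by fun_prop
    exact hc.memLp_of_hasCompactSupport (HasCompactSupport.of_compactSpace _)
  choose u hu using fun x => E.exists_hasIntegral (hmem x)
  -- Change of variables along ψ turns φ into φ ∘ ψ, the identity on the spectrum; quadratic forms
  -- then determine the operator.
  have hinner : ∀ x, ⟪x, u x⟫_ℂ = ⟪x, T x⟫_ℂ := fun x => by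
    rw [(hu x).inner_self, hE, integral_map hψ'.aemeasurable hφ'.aestronglyMeasurable]
    simp_rw [hφψ]
    have h1 := π.inner_eq_integral ((ContinuousMap.id ℝ).restrict (spectrum ℝ T)) x
    have h2 : π ((ContinuousMap.id ℝ).restrict (spectrum ℝ T)) = T := cfcHom_id hT
    rw [h2] at h1
    rw [h1]
    exact integral_ofReal
  let L : 𝓗 →ₗ[ℂ] 𝓗 :=
    { toFun := u
      map_add' := fun x y => (hu (x + y)).unique ((hu x).add (hu y))
      map_smul' := fun c x => (hu (c • x)).unique ((hu x).smul c) }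
  have hL : L = T := (ext_inner_map _ _).1 fun x => by
    rw [← inner_conj_symm, ← inner_conj_symm _ x]
    exact congrArg _ (hinner x)
  intro x
  have h := hu x
  have : u x = T x := DFunLike.congr_fun hL x
  rwa [this] at h
end

/-! ### The resolvent (1 + Δ)⁻¹ and the spectral theorem for Δ. -/

noncomputable section

theorem ProjValuedMeasure.eq_zero_of_ae_false {𝓗 : Type*} [NormedAddCommGroup 𝓗]
    [InnerProductSpace ℂ 𝓗] [CompleteSpace 𝓗] {E : ProjValuedMeasure 𝓗} {x : 𝓗}
    (h : ∀ᵐ _ ∂E.scalarMeasure x, False) : x = 0 := by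
  have h3 : E.scalarMeasure x Set.univ = 0 := by simpa [ae_iff] using h
  rw [E.scalarMeasure_apply x MeasurableSet.univ, E.proj_univ, one_apply_eq_self] at h3
  simpa using h3

theorem ProjValuedMeasure.HasIntegral.eq_zero_of_neg {𝓗 : Type*} [NormedAddCommGroup 𝓗]
    [InnerProductSpace ℂ 𝓗] [CompleteSpace 𝓗] {E : ProjValuedMeasure 𝓗} {x : 𝓗}
    (h : E.HasIntegral (fun t => (t : ℂ)) x (-x)) (hae : ∀ᵐ t ∂E.scalarMeasure x, 1 + t ≠ 0) :
    x = 0 := by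
  have h1 := (h.sub_fun (hasIntegral_const (-1) x)).enorm_eq
  rw [neg_one_smul, sub_self, enorm_zero] at h1
  have h2 := (eLpNorm_eq_zero_iff (Measurable.aestronglyMeasurable (by fun_prop))
    (by norm_num)).1 h1.symm
  refine eq_zero_of_ae_false (E := E) ?_
  filter_upwards [h2, hae] with t ht ht'
  refine ht' ?_
  simp only [Pi.sub_apply, sub_neg_eq_add, Pi.zero_apply] at ht
  rw [add_comm]
  exact_mod_cast ht

namespace StandardSubspace

variable {𝓗 : Type*} [NormedAddCommGroup 𝓗] [InnerProductSpace ℂ 𝓗] {K : StandardSubspace 𝓗}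

theorem modularOperator_graph : K.modularOperator.graph = K.modularGraph :=
  Submodule.toLinearPMap_graph_eq _ K.modularGraph_single_valued

theorem tomita_apply (x : K.tomita.domain) {h k : 𝓗} (hh : h ∈ K.toClosedSubmodule.toSubmodule)
    (hk : k ∈ K.toClosedSubmodule.toSubmodule) (e : (x : 𝓗) = h + I • k) :
    K.tomita x = h - I • k := by
  obtain ⟨h1, h2⟩ := K.parts_eq hh hk e
  rw [← h1, ← h2]
  rfl

theorem exists_tomita_eq (x : K.tomita.domain) : ∃ h ∈ K.toClosedSubmodule.toSubmodule,
    ∃ k ∈ K.toClosedSubmodule.toSubmodule, (x : 𝓗) = h + I • k ∧ K.tomita x = h - I • k :=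
  ⟨_, K.rePart_mem x, _, K.imPart_mem x, K.rePart_add_imPart x, rfl⟩

theorem eq_zero_of_tomita_eq_zero {x : K.tomita.domain} (hx : K.tomita x = 0) : (x : 𝓗) = 0 := by
  obtain ⟨h, hh, k, hk, e, e'⟩ := exists_tomita_eq x
  obtain ⟨rfl, h2⟩ := K.decomp_unique (h := h) (k := -k) (h' := 0) (k' := 0) hh
    (neg_mem hk) (zero_mem _) (zero_mem _) (by
      rw [smul_neg, ← sub_eq_add_neg, ← e', hx]; simp)
  rw [e, neg_eq_zero.1 h2]
  simp

/-- `⟨Δx, x⟩ = ‖Sx‖²`. -/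
theorem exists_inner_eq_norm_tomita_sq {p : 𝓗 × 𝓗} (hp : p ∈ K.modularGraph) :
    ∃ x : K.tomita.domain, (x : 𝓗) = p.1 ∧ ⟪p.2, p.1⟫_ℂ = ((‖K.tomita x‖ ^ 2 : ℝ) : ℂ) := by
  obtain ⟨x, hx, h⟩ := hp
  refine ⟨x, hx, ?_⟩
  rw [← hx, h x, inner_self_eq_norm_sq_to_K, Complex.ofReal_pow]
  rfl

theorem modularGraph_symmetric {p q : 𝓗 × 𝓗} (hp : p ∈ K.modularGraph)
    (hq : q ∈ K.modularGraph) : ⟪p.2, q.1⟫_ℂ = ⟪p.1, q.2⟫_ℂ := by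
  obtain ⟨x, hx, h⟩ := hp
  obtain ⟨y, hy, h'⟩ := hq
  rw [← hy, h y, ← inner_conj_symm p.1, ← hx, h' x, inner_conj_symm]

/-- Positivity ⟨Δu, u⟩ = ‖Su‖² ≥ 0 gives ‖u‖² ≤ Re⟨x, u⟩. This is both the uniqueness of the
resolvent and its bound. -/
theorem norm_le_of_modularGraph {u x : 𝓗} (h : (u, x - u) ∈ K.modularGraph) : ‖u‖ ≤ ‖x‖ := by
  obtain ⟨z, -, hz⟩ := exists_inner_eq_norm_tomita_sq h
  have h1 := congrArg Complex.re hz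
  rw [Complex.ofReal_re, inner_sub_left, Complex.sub_re] at h1
  have h2 := inner_self_eq_norm_sq (𝕜 := ℂ) u
  have h3 := re_inner_le_norm (𝕜 := ℂ) x u
  rw [RCLike.re_to_complex] at h2 h3
  by_contra! hlt
  nlinarith [norm_nonneg x, norm_nonneg u, sq_nonneg ‖K.tomita z‖]

theorem eq_of_modularGraph {u v x : 𝓗} (hu : (u, x - u) ∈ K.modularGraph)
    (hv : (v, x - v) ∈ K.modularGraph) : u = v := by
  have h := K.modularGraph.sub_mem hu hv
  have h' : (u - v, 0 - (u - v)) ∈ K.modularGraph := by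
    convert h using 1
    ext <;> simp
  have := norm_le_of_modularGraph h'
  rw [norm_zero, norm_le_zero_iff] at this
  exact sub_eq_zero.1 this

open ClosedSubmodule in
theorem exists_realProj [CompleteSpace 𝓗] (M : ClosedSubmodule ℝ 𝓗) (x : 𝓗) :
    ∃ p ∈ M.toSubmodule, ∀ z ∈ M.toSubmodule, (⟪x, z⟫_ℂ).re = (⟪p, z⟫_ℂ).re := by
  have : IsClosed (M.toSubmodule : Set 𝓗) := M.isClosed'
  have : CompleteSpace M.toSubmodule := this.completeSpace_coe
  refine ⟨M.toSubmodule.starProjection x, Submodule.starProjection_apply_mem _ _, fun z hz => ?_⟩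
  have h := Submodule.starProjection_inner_eq_zero (K := M.toSubmodule) x z hz
  rw [inner_real_eq_re_inner, inner_sub_left, Complex.sub_re] at h
  exact sub_eq_zero.1 h

/-- The range of `1 + Δ` is everything. -/
theorem exists_modularGraph_sub [CompleteSpace 𝓗] (K : StandardSubspace 𝓗) (x : 𝓗) :
    ∃ u, (u, x - u) ∈ K.modularGraph := by
  -- The equation to solve is ⟨u, h⟩ + ⟨h, Su⟩ = ⟨x, h⟩ for h ∈ K. With u = a + ib and a, b ∈ K, the
  -- left side is 2Re⟨a, h⟩ - 2i Re⟨b, h⟩, so a and b are half the real projections onto K of x and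
  -- -ix.
  obtain ⟨p, hp, hp'⟩ := exists_realProj K.toClosedSubmodule x
  obtain ⟨q, hq, hq'⟩ := exists_realProj K.toClosedSubmodule (-(I • x))
  have hp2 : (1 / 2 : ℝ) • p ∈ K.toClosedSubmodule.toSubmodule := Submodule.smul_mem _ _ hp
  have hq2 : (1 / 2 : ℝ) • q ∈ K.toClosedSubmodule.toSubmodule := Submodule.smul_mem _ _ hq
  let u : K.tomita.domain := ⟨(1 / 2 : ℝ) • p + I • ((1 / 2 : ℝ) • q), ⟨_, hp2, _, hq2, rfl⟩⟩
  have hu : K.tomita u = (1 / 2 : ℝ) • p - I • ((1 / 2 : ℝ) • q) := tomita_apply u hp2 hq2 rfl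
  have key : ∀ h ∈ K.toClosedSubmodule.toSubmodule, ⟪x - u, h⟫_ℂ = ⟪h, K.tomita u⟫_ℂ := by
    intro h hh
    have h1 := hp' h hh
    have h2 := hq' h hh
    rw [hu]
    simp only [u, ← Complex.coe_smul, inner_sub_left, inner_add_left, inner_sub_right,
      inner_smul_left, inner_smul_right]
    have e1 := inner_re_symm (𝕜 := ℂ) h p
    have e2 := inner_im_symm (𝕜 := ℂ) h p
    have e3 := inner_re_symm (𝕜 := ℂ) h q
    have e4 := inner_im_symm (𝕜 := ℂ) h q
    simp only [inner_neg_left, inner_smul_left, Complex.conj_I] at h2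
    apply Complex.ext
    · simp at h1 h2 e1 e2 e3 e4 ⊢
      linarith
    · simp at h1 h2 e1 e2 e3 e4 ⊢
      linarith
  refine ⟨u, u, rfl, fun z => ?_⟩
  obtain ⟨h, hh, k, hk, e, e'⟩ := exists_tomita_eq z
  rw [e, e', inner_add_right, inner_smul_right, key h hh, key k hk, inner_sub_left,
    inner_smul_left, Complex.conj_I]
  ring

/-- The bounded operator `(1 + Δ)⁻¹`. -/
theorem exists_resolvent [CompleteSpace 𝓗] (K : StandardSubspace 𝓗) :
    ∃ T : 𝓗 →L[ℂ] 𝓗, IsSelfAdjoint T ∧ ∀ x, (T x, x - T x) ∈ K.modularGraph := by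
  choose u hu using K.exists_modularGraph_sub
  have huniq : ∀ {x v : 𝓗}, (v, x - v) ∈ K.modularGraph → u x = v :=
    fun hv => eq_of_modularGraph (hu _) hv
  let L : 𝓗 →ₗ[ℂ] 𝓗 :=
    { toFun := u
      map_add' := fun x y => huniq (by
        convert K.modularGraph.add_mem (hu x) (hu y) using 1
        ext
        · rfl
        · simp; abel)
      map_smul' := fun c x => huniq (by
        convert K.modularGraph.smul_mem c (hu x) using 1
        ext
        · rfl
        · simp [smul_sub]) }
  let T : 𝓗 →L[ℂ] 𝓗 := L.mkContinuous 1 fun x => by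
    rw [one_mul]; exact norm_le_of_modularGraph (hu x)
  refine ⟨T, ?_, hu⟩
  rw [ContinuousLinearMap.isSelfAdjoint_iff_isSymmetric]
  intro x y
  have h := modularGraph_symmetric (hu x) (hu y)
  change ⟪u x, y⟫_ℂ = ⟪x, u y⟫_ℂ
  simp only [inner_sub_left, inner_sub_right] at h
  linear_combination -h

/-- The spectral theorem for the modular operator. -/
theorem exists_integral_eq_modularOperator [CompleteSpace 𝓗] (K : StandardSubspace 𝓗) :
    ∃ E : ProjValuedMeasure 𝓗, E.integral (fun t => (t : ℂ)) = K.modularOperator := by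
  obtain ⟨T, hT, hTK⟩ := K.exists_resolvent
  -- ψ inverts φ even at 0: since 0⁻¹ = 0, the point 0 is sent to -1 and back to 0.
  obtain ⟨E, hE⟩ := hT.exists_projValuedMeasure (fun t => (1 + t)⁻¹) (fun t => t⁻¹ - 1)
    (by fun_prop) (by fun_prop) (by simp)
  have hTinj : ∀ x, T x = 0 → x = 0 := fun x hx => by
    have := K.modularGraph_single_valued _ (hTK x) hx
    simpa [hx] using this
  -- The artificial point -1 carries no mass: (1 + t)⁻¹ takes the value 0 there, so T kills the
  -- range of E{-1}, and T is injective.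
  have hpoint : E.proj {-1} = 0 := by
    ext x
    refine hTinj _ ?_
    have hs := E.hasIntegral_simpleFunc (SimpleFunc.piecewise {-1} (measurableSet_singleton _)
      (SimpleFunc.const ℝ 1) (SimpleFunc.const ℝ 0)) x
    rw [ProjValuedMeasure.simpleIntegral_piecewise, one_smul] at hs
    have h1 := (hE (E.proj {-1} x)).enorm_eq
    rw [hs.eLpNorm_eq] at h1
    have h2 : (fun t : ℝ => (((1 + t)⁻¹ : ℝ) : ℂ)) * ⇑(SimpleFunc.piecewise {-1}
        (measurableSet_singleton (-1 : ℝ)) (SimpleFunc.const ℝ (1 : ℂ)) (SimpleFunc.const ℝ 0)) =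
        0 := by
      ext t
      by_cases ht : t = -1 <;> simp [ht]
    rw [h2] at h1
    simpa using h1
  have hae : ∀ x, ∀ᵐ t ∂E.scalarMeasure x, 1 + t ≠ 0 := fun x => by
    refine measure_mono_null (t := {-1}) ?_ ?_
    · intro t ht
      simp only [Set.mem_compl_iff, Set.mem_ofPred_eq, not_not] at ht
      simp only [Set.mem_singleton_iff]
      linarith
    · rw [E.scalarMeasure_apply x (measurableSet_singleton _), hpoint]
      simp
  -- Multiplicativity with t(1 + t)⁻¹ = 1 - (1 + t)⁻¹, valid off t = -1.
  have hle : ∀ x, E.HasIntegral (fun t => (t : ℂ)) (T x) (x - T x) := fun x => by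
    refine (hE x).comp (by fun_prop) ?_
    have h := (ProjValuedMeasure.hasIntegral_const 1 x).sub_fun (hE x)
    rw [one_smul] at h
    refine h.congr ?_
    filter_upwards [hae x] with t ht
    have ht' : (1 + t : ℂ) ≠ 0 := by exact_mod_cast ht
    simp only [Pi.sub_apply, Pi.mul_apply, Complex.ofReal_inv, Complex.ofReal_add,
      Complex.ofReal_one]
    field_simp
    ring
  refine ⟨E, LinearPMap.eq_of_eq_graph ?_⟩
  rw [E.integral_graph, modularOperator_graph]
  refine le_antisymm ?_ ?_
  · rintro ⟨x, y⟩ (h : E.HasIntegral _ x y)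
    -- Subtracting the graph point supplied by the resolvent at x + y leaves a vector satisfying the
    -- eigenvalue equation for -1, hence zero.
    have h0 : E.HasIntegral (fun t => (t : ℂ)) (x - T (x + y)) (-(x - T (x + y))) := by
      have := h.add ((hle (x + y)).smul (-1))
      rwa [show x + (-1 : ℂ) • T (x + y) = x - T (x + y) by module,
        show y + (-1 : ℂ) • (x + y - T (x + y)) = -(x - T (x + y)) by module] at this
    have h1 : T (x + y) = x := (sub_eq_zero.1 (h0.eq_zero_of_neg (hae _))).symm
    have := hTK (x + y)
    rwa [h1, add_sub_cancel_left] at this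
  · rintro ⟨x, y⟩ h
    have h1 : T (x + y) = x := eq_of_modularGraph (hTK (x + y)) (by simpa using h)
    have := hle (x + y)
    rwa [h1, add_sub_cancel_left] at this

end StandardSubspace
end

/-! ### The range of 1 - Δ, positivity of the spectrum, and the factorization of f(Δ). -/

noncomputable section

theorem ProjValuedMeasure.scalarMeasure_proj {𝓗 : Type*} [NormedAddCommGroup 𝓗]
    [InnerProductSpace ℂ 𝓗] [CompleteSpace 𝓗] (E : ProjValuedMeasure 𝓗) {B : Set ℝ}
    (hB : MeasurableSet B) (x : 𝓗) :
    E.scalarMeasure (E.proj B x) = (E.scalarMeasure x).restrict B := by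
  ext C hC
  rw [Measure.restrict_apply hC, E.scalarMeasure_apply _ hC,
    E.scalarMeasure_apply _ (hC.inter hB), E.proj_inter C B hC hB]
  rfl

namespace StandardSubspace

variable {𝓗 : Type*} [NormedAddCommGroup 𝓗] [InnerProductSpace ℂ 𝓗] {K : StandardSubspace 𝓗}

/-- `Ran(1 - Δ) ⊆ K + K'`. -/
theorem sub_mem_sumSymplComp {u v : 𝓗} (h : (u, v) ∈ K.modularGraph) :
    u - v ∈ K.sumSymplComp := by
  obtain ⟨x, rfl, hx⟩ := h
  obtain ⟨h, hh, k, hk, e, e'⟩ := exists_tomita_eq x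
  have h1 : (2 : ℝ) • h ∈ K.toClosedSubmodule.toSubmodule := Submodule.smul_mem _ _ hh
  -- For y ∈ K the defining relation of Δ, tested at Sy = y, makes ⟨y, Sx⟩ and ⟨y, Δx⟩ complex
  -- conjugates.
  have h2 : K.tomita x + v ∈ K.toClosedSubmodule.symplComp.toSubmodule := by
    refine ClosedSubmodule.mem_symplComp_iff.2 fun y hy => ?_
    let z : K.tomita.domain := ⟨y, y, hy, 0, zero_mem _, by simp⟩
    have h3 := hx z
    rw [tomita_apply z (h := y) (k := 0) hy (zero_mem _) (by simp [z]), smul_zero, sub_zero] at h3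
    rw [inner_add_right, ← h3, Complex.add_im]
    exact add_eq_zero_iff_eq_neg.2 (inner_im_symm (𝕜 := ℂ) v y)
  have h3 : (x : 𝓗) - v = (2 : ℝ) • h - (K.tomita x + v) := by
    rw [e', e]
    module
  rw [h3]
  exact sub_mem (Submodule.mem_sup_left h1) (Submodule.mem_sup_right h2)

variable [CompleteSpace 𝓗] {E : ProjValuedMeasure 𝓗}

/-- The measure is the one chosen inside `borelCalculus`. Only ∫ λ dE = Δ is used about it later, so
uniqueness of the spectral measure is not needed. -/
theorem exists_modularCalculus_eq (K : StandardSubspace 𝓗) :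
    ∃ E : ProjValuedMeasure 𝓗, E.integral (fun t => (t : ℂ)) = K.modularOperator ∧
      ∀ f, K.modularCalculus f = E.integral f :=
  ⟨_, K.exists_integral_eq_modularOperator.choose_spec, fun _ =>
    dif_pos K.exists_integral_eq_modularOperator⟩

theorem mem_modularGraph_iff (hE : E.integral (fun t => (t : ℂ)) = K.modularOperator) {x y : 𝓗} :
    (x, y) ∈ K.modularGraph ↔ E.HasIntegral (fun t => (t : ℂ)) x y := by
  rw [← modularOperator_graph, ← hE, E.integral_graph]
  rfl

/-- The spectral measure of `Δ` is concentrated on `(0, ∞)`. -/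
theorem ae_pos (hE : E.integral (fun t => (t : ℂ)) = K.modularOperator) (x : 𝓗) :
    ∀ᵐ t ∂E.scalarMeasure x, 0 < t := by
  -- Cutting to the bounded set [-n, 0] puts z in Dom Δ. There ‖Sz‖² = ∫ t ≤ 0, and S is injective,
  -- so z = 0; including the endpoint 0 gives non-singularity of Δ.
  have key : ∀ n : ℕ, E.scalarMeasure x (Set.Icc (-n : ℝ) 0) = 0 := fun n => by
    have hB : MeasurableSet (Set.Icc (-n : ℝ) 0) := measurableSet_Icc
    set z := E.proj (Set.Icc (-n : ℝ) 0) x with hz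
    have hmeas : AEStronglyMeasurable (fun t : ℝ => (t : ℂ)) (E.scalarMeasure z) :=
      Measurable.aestronglyMeasurable (by fun_prop)
    have hae : ∀ᵐ t ∂E.scalarMeasure z, t ∈ Set.Icc (-n : ℝ) 0 := by
      rw [hz, E.scalarMeasure_proj hB]
      exact ae_restrict_mem hB
    have hm : MemLp (fun t : ℝ => (t : ℂ)) 2 (E.scalarMeasure z) := by
      refine MemLp.of_bound hmeas n ?_
      filter_upwards [hae] with t ht
      rw [Complex.norm_real, Real.norm_eq_abs, abs_le]
      exact ⟨ht.1, ht.2.trans n.cast_nonneg⟩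
    obtain ⟨y, hy⟩ := E.exists_hasIntegral hm
    obtain ⟨w, hw, hw'⟩ := exists_inner_eq_norm_tomita_sq ((mem_modularGraph_iff hE).2 hy)
    have h1 := hy.inner_self
    have h2 : ∫ t, t ∂E.scalarMeasure z ≤ 0 := by
      refine integral_nonpos_of_ae ?_
      filter_upwards [hae] with t ht using ht.2
    rw [← inner_conj_symm, hw', Complex.conj_ofReal, integral_complex_ofReal] at h1
    have h3 : ‖K.tomita w‖ ^ 2 = ∫ t, t ∂E.scalarMeasure z := by exact_mod_cast h1
    have h4 : K.tomita w = 0 := by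
      rw [← norm_eq_zero, ← sq_eq_zero_iff]
      exact le_antisymm (h3.trans_le h2) (sq_nonneg _)
    have h5 : z = 0 := hw.symm.trans (eq_zero_of_tomita_eq_zero h4)
    rw [E.scalarMeasure_apply x hB, ← hz, h5]
    simp
  refine measure_mono_null (t := ⋃ n : ℕ, Set.Icc (-n : ℝ) 0) (fun t ht => ?_)
    (measure_iUnion_null key)
  obtain ⟨n, hn⟩ := exists_nat_ge (-t)
  exact Set.mem_iUnion.2 ⟨n, by linarith, not_lt.1 ht⟩

theorem mem_sumSymplComp_of_isBigO (hE : E.integral (fun t => (t : ℂ)) = K.modularOperator)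
    {f : ℝ → ℂ} (hf : f =O[𝓝 1] fun t : ℝ => t - 1) {x k : 𝓗} (h : E.HasIntegral f x k) :
    k ∈ K.sumSymplComp := by
  have hf1 : f 1 = 0 := hf.eq_zero_imp.self_of_nhds (sub_self 1)
  obtain ⟨C, hC, hfC⟩ := hf.exists_pos
  obtain ⟨δ, hδ, hball⟩ := Metric.eventually_nhds_iff.1 hfC.bound
  -- At t = 1 the quotient is 0 by convention; the identity tg = g - f still holds there because
  -- f(1) = 0.
  let g : ℝ → ℂ := fun t => f t / (1 - t)
  have hgb : ∀ t, ‖g t‖ ≤ C + δ⁻¹ * ‖f t‖ := fun t => by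
    have hn : ‖g t‖ = ‖f t‖ / |t - 1| := by
      simp only [g, norm_div]
      rw [← Complex.ofReal_one, ← Complex.ofReal_sub, Complex.norm_real, Real.norm_eq_abs,
        abs_sub_comm]
    rw [hn]
    have h0 : 0 ≤ δ⁻¹ * ‖f t‖ := by positivity
    rcases lt_or_ge |t - 1| δ with ht | ht
    · have h1 := hball (y := t) (by rwa [Real.dist_eq])
      rw [Real.norm_eq_abs] at h1
      have : ‖f t‖ / |t - 1| ≤ C := div_le_of_le_mul₀ (abs_nonneg _) hC.le h1
      linarith
    · have : ‖f t‖ / |t - 1| ≤ ‖f t‖ / δ := by gcongr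
      rw [div_eq_inv_mul _ δ] at this
      linarith
  have hgm : MemLp g 2 (E.scalarMeasure x) := by
    refine MemLp.mono' ((memLp_const C).add (h.1.norm.const_mul δ⁻¹)) ?_
      (Eventually.of_forall hgb)
    exact h.1.1.aemeasurable.div (f := f) (g := fun t => 1 - (t : ℂ)) (by fun_prop)
      |>.aestronglyMeasurable
  obtain ⟨u, hu⟩ := E.exists_hasIntegral hgm
  have hmul : (fun t : ℝ => (t : ℂ)) * g = g - f := by
    ext t
    rcases eq_or_ne t 1 with rfl | ht
    · simp [g, hf1]
    · have ht' : (1 - t : ℂ) ≠ 0 := by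
        rw [sub_ne_zero]
        exact_mod_cast ht.symm
      simp only [g, Pi.mul_apply, Pi.sub_apply]
      field_simp
      ring
  -- With u = g(Δ)x this says Δu = u - k, so k = u - Δu lies in the range of 1 - Δ.
  have h1 := (mem_modularGraph_iff hE).2 (hu.comp (by fun_prop) (hmul ▸ hu.sub_fun h))
  simpa using sub_mem_sumSymplComp h1

end StandardSubspace

end

theorem corollary2p3 {𝓗 : Type*} [NormedAddCommGroup 𝓗] [InnerProductSpace ℂ 𝓗] [CompleteSpace 𝓗]
    (K : StandardSubspace 𝓗) (hK : K.IsFactorial) :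
    (∀ f : ℝ → ℂ, ContinuousOn f (Set.Ioi 0) →
      f =O[𝓝[≠] (1 : ℝ)] (fun t : ℝ => t - 1) →
      ∀ k : (K.modularCalculus f).domain, K.modularCalculus f k ∈ K.sumSymplComp) ∧
    (∀ s : ℝ, (K.modularPow s).domain = ⊤ ∧
      ∀ k : (K.modularPow s).domain, (k : 𝓗) - K.modularPow s k ∈ K.sumSymplComp) ∧
    (∀ k : K.logModular.domain, K.logModular k ∈ K.sumSymplComp) := by
  obtain ⟨E, hE, hcalc⟩ := K.exists_modularCalculus_eq
  refine ⟨fun f hfc hf => ?_, fun s => ?_, ?_⟩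
  · have hf1 : f 1 = 0 := by
      have h0 : Tendsto (fun t : ℝ => t - 1) (𝓝[≠] 1) (𝓝 0) := by
        have : ContinuousAt (fun t : ℝ => t - 1) 1 := by fun_prop
        simpa [ContinuousAt] using this.tendsto.mono_left (nhdsWithin_le_nhds (s := {1}ᶜ))
      have hc : ContinuousAt f 1 := hfc.continuousAt (Ioi_mem_nhds one_pos)
      exact tendsto_nhds_unique (hc.tendsto.mono_left nhdsWithin_le_nhds) (hf.trans_tendsto h0)
    have hf' : f =O[𝓝 1] fun t : ℝ => t - 1 := by
      rw [← nhdsNE_sup_pure, isBigO_sup]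
      exact ⟨hf, isBigO_pure.2 fun _ => hf1⟩
    rw [hcalc f]
    exact fun k => StandardSubspace.mem_sumSymplComp_of_isBigO hE hf' (E.hasIntegral_integral f k)
  · have hmeas : Measurable fun t : ℝ => (t : ℂ) ^ (I * s) := by fun_prop
    have hd : DifferentiableAt ℝ (fun t : ℝ => 1 - (t : ℂ) ^ (I * s)) 1 := by
      -- The differentiability rule for t ↦ t^{is} needs a nonzero exponent; for s = 0 the function
      -- is identically 0.
      rcases eq_or_ne s 0 with rfl | hs
      · simp
      · exact (differentiableAt_const _).sub (differentiableAt_id.ofReal_cpow_const one_ne_zero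
          (mul_ne_zero I_ne_zero (by exact_mod_cast hs)))
    have hO : (fun t : ℝ => 1 - (t : ℂ) ^ (I * s)) =O[𝓝 1] fun t : ℝ => t - 1 := by
      simpa using hd.isBigO_sub
    rw [StandardSubspace.modularPow, hcalc]
    refine ⟨?_, fun k => ?_⟩
    · refine eq_top_iff.2 fun x _ => (E.mem_integral_domain _ x).2 ?_
      refine MemLp.of_bound hmeas.aestronglyMeasurable 1 ?_
      -- For t > 0 the modulus of t^{is} is t⁰ = 1; the principal branch would give e^{-πs} on
      -- negative t.
      filter_upwards [StandardSubspace.ae_pos hE x] with t ht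
      rw [Complex.norm_cpow_eq_rpow_re_of_pos ht]
      simp
    · have h1 : E.HasIntegral (fun _ => 1) (k : 𝓗) k := by
        simpa using ProjValuedMeasure.hasIntegral_const (E := E) 1 (k : 𝓗)
      exact StandardSubspace.mem_sumSymplComp_of_isBigO hE hO (h1.sub_fun (E.hasIntegral_integral _ k))
  · have hd : DifferentiableAt ℝ (fun t : ℝ => (Real.log t : ℂ)) 1 :=
      ((Real.hasDerivAt_log one_ne_zero).ofReal_comp).differentiableAt
    rw [StandardSubspace.logModular, hcalc]
    exact fun k => StandardSubspace.mem_sumSymplComp_of_isBigO hE (by simpa using hd.isBigO_sub)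
      (E.hasIntegral_integral _ k)
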